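/- Let $R$ be a commutative Dedekind domain, let $M$ be a set of maximal ideals of $R$, let $n_P\in\mathbb N$ for $P\in M$, and put $L=\bigcup_{P\in M}\{P\}\times[1,n_P]$ and $\mathcal F_L=\{R/P^{l}\mid (P,l)\in L\}$. Let $\mathcal C$ be the category of finitely generated $R$-modules. For a set $\mathcal U$ of indecomposable pure-injective $R$-modules (up to isomorphism) let $\mathcal E^{\mathcal U}$ be the class of all short exact sequences $\sigma$ in $\mathcal C$ such that $\operatorname{Hom}_R(\sigma,U)$ is exact for all $U\in\mathcal U$. For such a class $\mathcal E$ let $\operatorname{Ext}^1_{\mathcal E}(X,Y)\subseteq\operatorname{Ext}^1_R(X,Y)$ be the set of classes of the sequences $Y\rightarrowtail Z\twoheadrightarrow X$ in $\mathcal E$. The set $\mathcal U$ is Ziegler-closed if it consists of all indecomposable pure-injective modules in a definable subcategory of $R$-modules, that is, of all those $N$ for which $\operatorname{Hom}_R(s,N)$ is surjective for all $s$ in some class of maps of finitely presented modules. An exact structure $\mathcal E$ is called hereditary exact if Yoneda's $\operatorname{Ext}^2_{\mathcal E}$ vanishes. For an $R$-module $V$ we write $V_P$ for its $P$-primary torsion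 submodule and $V_{tor(M^c)}=\sum_{Q\notin M}V_Q$. Let $\mathcal U_{max}$ be the set of indecomposable injective modules, and $\overline R_P$ the $P$-adic completion of $R$. (1) Let $\mathcal U$ be a Ziegler-closed set whose points of finite length are exactly those of $\mathcal F_L$. Then $\mathcal E^{\mathcal U}$ is an exact structure on $\mathcal C$ and it is hereditary exact. Let moreover $A=\{P\mid\overline R_P\in\mathcal U\}$ and $\mathcal E'_A=\mathcal E^{\,\mathcal U_{max}\cup\{\overline R_P\mid P\in A\}}$. Then for all $X,Y\in\mathcal C$ the subset $\operatorname{Ext}^1_{\mathcal E'_A}(X,Y)$ of $\operatorname{Ext}^1_R(X,Y)$ is a submodule, and as an internal direct sum \[\operatorname{Ext}^1_{\mathcal E^{\mathcal U}}(X,Y)=\bigoplus_{P\in M}P^{n_P}\bigl(\operatorname{Ext}^1_{\mathcal E'_A}(X,Y)\bigr)_P\;\oplus\;\bigl(\operatorname{Ext}^1_{\mathcal E'_A}(X,Y)\bigr)_{tor(M^c)} .\] (2) The class $\mathcal E_L=\mathcal E^{\,\mathcal F_L\cup\,\mathcal U_{max}}$ is an exact structure on $\mathcal C$, it is hereditary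 exact, and for all $X,Y\in\mathcal C$, as an internal direct sum, \[\operatorname{Ext}^1_{\mathcal E_L}(X,Y)=\bigoplus_{P\in M}P^{n_P}\bigl(\operatorname{Ext}^1_R(X,Y)\bigr)_P\;\oplus\;\bigl(\operatorname{Ext}^1_R(X,Y)\bigr)_{tor(M^c)} .\] -/

import Mathlib

open CategoryTheory Limits

universe u v w

noncomputable section

namespace DedekindExact

/-! ### Exact structures and Yoneda `Ext²` -/

section ExactStructures

variable {C : Type w} [Category.{v} C] [Preadditive C]

/-- `f` is an inflation: the first map of a member `A ↣ B ↠ Z` of the class `E`. -/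
def IsInflation (E : ObjectProperty (ShortComplex C)) {A B : C} (f : A ⟶ B) : Prop :=
  ∃ (Z : C) (g : B ⟶ Z) (h : f ≫ g = 0), E (ShortComplex.mk f g h)

/-- `g` is a deflation: the second map of a member `K ↣ B ↠ Z` of the class `E`. -/
def IsDeflation (E : ObjectProperty (ShortComplex C)) {B Z : C} (g : B ⟶ Z) : Prop :=
  ∃ (K : C) (f : K ⟶ B) (h : f ≫ g = 0), E (ShortComplex.mk f g h)

/-- `E` is an exact structure in the sense of Quillen (the axioms `E0`, `E1`, `E2` and their duals,
in Bühler's form). -/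
structure IsExactStructure (E : ObjectProperty (ShortComplex C)) : Prop where
  /-- Every member is a kernel-cokernel pair. -/
  kernel_cokernel : ∀ S : ShortComplex C, E S →
    Nonempty (IsLimit (KernelFork.ofι S.f S.zero)) ∧
      Nonempty (IsColimit (CokernelCofork.ofπ S.g S.zero))
  iso_closed : E.IsClosedUnderIsomorphisms
  id_inflation : ∀ X : C, IsInflation E (𝟙 X)
  id_deflation : ∀ X : C, IsDeflation E (𝟙 X)
  comp_inflation : ∀ {X Y Z : C} (f : X ⟶ Y) (g : Y ⟶ Z),
    IsInflation E f → IsInflation E g → IsInflation E (f ≫ g)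
  comp_deflation : ∀ {X Y Z : C} (f : X ⟶ Y) (g : Y ⟶ Z),
    IsDeflation E f → IsDeflation E g → IsDeflation E (f ≫ g)
  pushout_inflation : ∀ {A B A' : C} (i : A ⟶ B) (a : A ⟶ A'), IsInflation E i →
    ∃ (B' : C) (b : B ⟶ B') (i' : A' ⟶ B'), IsPushout i a b i' ∧ IsInflation E i'
  pullback_deflation : ∀ {B Z Z' : C} (p : B ⟶ Z) (z : Z' ⟶ Z), IsDeflation E p →
    ∃ (B' : C) (b : B' ⟶ B) (p' : B' ⟶ Z'), IsPullback b p' p z ∧ IsDeflation E p'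

/-- A `2`-extension `X ↣ Y₁ ⟶ Y₀ ↠ Z` spliced from the members `X ↣ Y₁ ↠ W` and `W ↣ Y₀ ↠ Z`
of `E`. -/
structure TwoExtension (E : ObjectProperty (ShortComplex C)) (Z X : C) where
  Y₁ : C
  W : C
  Y₀ : C
  i : X ⟶ Y₁
  p : Y₁ ⟶ W
  j : W ⟶ Y₀
  q : Y₀ ⟶ Z
  ip : i ≫ p = 0
  jq : j ≫ q = 0
  left_mem : E (ShortComplex.mk i p ip)
  right_mem : E (ShortComplex.mk j q jq)

/-- There is a morphism of `2`-extensions from `s` to `t` that is the identity on both ends. -/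
def TwoExtension.HasMorphism {E : ObjectProperty (ShortComplex C)} {Z X : C}
    (s t : TwoExtension E Z X) : Prop :=
  ∃ (y₁ : s.Y₁ ⟶ t.Y₁) (c : s.W ⟶ t.W) (y₀ : s.Y₀ ⟶ t.Y₀),
    s.i ≫ y₁ = t.i ∧ s.p ≫ c = y₁ ≫ t.p ∧ s.j ≫ y₀ = c ≫ t.j ∧ y₀ ≫ t.q = s.q

/-- Yoneda's `Ext²_E(Z, X)`: the `2`-extensions modulo the equivalence relation generated by
`HasMorphism`. -/
def YonedaExtTwo (E : ObjectProperty (ShortComplex C)) (Z X : C) : Type (max w v) :=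
  Quot (TwoExtension.HasMorphism (E := E) (Z := Z) (X := X))

/-- A hereditary exact structure: an exact structure of global dimension at most one, that is,
`Ext²_E(Z, X)` has only one element, for all `Z` and `X`. -/
structure IsHereditaryExact (E : ObjectProperty (ShortComplex C)) : Prop where
  exact : IsExactStructure E
  ext_two : ∀ Z X : C, Subsingleton (YonedaExtTwo E Z X)

end ExactStructures

/-! ### Pure-injectives and Ziegler-closed sets -/

section Ziegler

variable {R : Type u} [CommRing R]

/-- A short exact sequence of modules is pure if every map from a finitely presented module to its
third term lifts to the middle term. -/
def IsPureExact (S : ShortComplex (ModuleCat.{u} R)) : Prop :=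
  S.ShortExact ∧ ∀ F : ModuleCat.{u} R, Module.FinitePresentation R F →
    ∀ f : F ⟶ S.X₃, ∃ g : F ⟶ S.X₂, g ≫ S.g = f

/-- A module is pure-injective if it is injective with respect to all pure exact sequences. -/
def IsPureInjective (N : ModuleCat.{u} R) : Prop :=
  ∀ S : ShortComplex (ModuleCat.{u} R), IsPureExact S →
    ∀ f : S.X₁ ⟶ N, ∃ g : S.X₂ ⟶ N, S.f ≫ g = f

/-- The points of the Ziegler spectrum of `R`: indecomposable (in particular nonzero)
pure-injective modules. Sets of points are isomorphism-invariant properties of modules. -/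
def IsZieglerPoint (N : ModuleCat.{u} R) : Prop :=
  Indecomposable N ∧ IsPureInjective N

/-- A set of points is Ziegler-closed if it consists of all points in a definable subcategory, the
class of all `N` such that `Hom(s, N)` is surjective for all `s` in some class of maps between
finitely presented modules. (Over a Noetherian ring, finitely presented means finitely
generated.) -/
def IsZieglerClosed (U : ObjectProperty (ModuleCat.{u} R)) : Prop :=
  ∃ T : MorphismProperty (FGModuleCat.{u} R), ∀ N : ModuleCat.{u} R,
    U N ↔ IsZieglerPoint N ∧
      ∀ ⦃A B : FGModuleCat.{u} R⦄ (s : A ⟶ B), T s →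
        ∀ f : A.obj ⟶ N, ∃ g : B.obj ⟶ N, s.hom ≫ g = f

/-- `𝒰_max`: the indecomposable injective modules. -/
def maxPoints (R : Type u) [CommRing R] : ObjectProperty (ModuleCat.{u} R) :=
  fun N => Indecomposable N ∧ Injective N

/-- `ℱ_L`: the modules isomorphic to `R / P ^ l` with `(P, l) ∈ L`. -/
def finiteLengthPoints (L : Set (MaximalSpectrum R × ℕ)) : ObjectProperty (ModuleCat.{u} R) :=
  fun N => ∃ P l, (P, l) ∈ L ∧ Nonempty (N ≅ ModuleCat.of R (R ⧸ P.asIdeal ^ l))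

/-- The `P`-adic completion of `R`, as an `R`-module. -/
def adic (P : MaximalSpectrum R) : ModuleCat.{u} R :=
  ModuleCat.of R (AdicCompletion P.asIdeal R)

/-- `Zg'_A`: the indecomposable injectives and the `P`-adic completions with `P ∈ A`. -/
def adicPoints (A : Set (MaximalSpectrum R)) : ObjectProperty (ModuleCat.{u} R) :=
  fun N => maxPoints R N ∨ ∃ P ∈ A, Nonempty (N ≅ adic P)

/-- `L = ⋃_{P ∈ M} {P} × [1, n_P]`. -/
def initialSegments (M : Set (MaximalSpectrum R)) (n : MaximalSpectrum R → ℕ) :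
    Set (MaximalSpectrum R × ℕ) :=
  ⋃ P ∈ M, {P} ×ˢ Set.Icc 1 (n P)

end Ziegler

/-! ### The exact structures `ℰ^𝒰` on finitely generated modules and their `Ext¹` -/

section Relative

variable {R : Type u} [CommRing R] [IsNoetherianRing R]

/-- `ℰ^𝒰`: the short exact sequences `σ` of finitely generated modules such that `Hom(σ, N)` is
exact for all `N` in `𝒰`; only the surjectivity of `Hom(S.X₂, N) ⟶ Hom(S.X₁, N)` is a condition. -/
def exactStructure (U : ObjectProperty (ModuleCat.{u} R)) :
    ObjectProperty (ShortComplex (FGModuleCat.{u} R)) :=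
  fun S => S.ShortExact ∧ ∀ N : ModuleCat.{u} R, U N →
    ∀ f : S.X₁.obj ⟶ N, ∃ g : S.X₂.obj ⟶ N, S.f.hom ≫ g = f

/-- `Ext¹_R(X, Y)`, an `R`-module. -/
abbrev ExtR (X Y : FGModuleCat.{u} R) : Type u :=
  Abelian.Ext X.obj Y.obj 1

/-- `Ext¹_E(X, Y)` as a subset of `Ext¹_R(X, Y)`: the classes of the sequences
`Y ↣ Z ↠ X` in `E`. -/
def extOne (E : ObjectProperty (ShortComplex (FGModuleCat.{u} R))) (X Y : FGModuleCat.{u} R) :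
    Set (ExtR X Y) :=
  {x | ∃ (Z : FGModuleCat.{u} R) (i : Y ⟶ Z) (p : Z ⟶ X) (h : i ≫ p = 0)
      (_ : E (ShortComplex.mk i p h))
      (hS : ((ShortComplex.mk i p h).map
        (forget₂ (FGModuleCat.{u} R) (ModuleCat.{u} R))).ShortExact),
      hS.extClass = x}

/-- The summands of the decomposition of a submodule `N` of a module `V`: for `P ∈ M` the submodule
`P ^ n_P · N_P`, where `N_P` is the `P`-primary torsion of `N`, and in addition the part of `N` in
the sum of the `Q`-primary torsion parts for all maximal ideals `Q ∉ M`. -/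
def radSummand {V : Type u} [AddCommGroup V] [Module R V] (M : Set (MaximalSpectrum R))
    (n : MaximalSpectrum R → ℕ) (N : Submodule R V) : Option M → Submodule R V
  | some P => P.1.asIdeal ^ n P.1 • (N ⊓ P.1.asIdeal.primaryComponent V)
  | none => N ⊓ ⨆ Q ∈ Mᶜ, Q.asIdeal.primaryComponent V

/-- The set `T` is the internal direct sum of the submodules `F k`. -/
def IsDirectSum {V : Type u} [AddCommGroup V] [Module R V] {κ : Type u}
    (T : Set V) (F : κ → Submodule R V) : Prop :=
  iSupIndep F ∧ T = ((⨆ k, F k : Submodule R V) : Set V)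

end Relative

end DedekindExact

end

/-! By the long exact sequence, a class in Ext¹_R(X, Y) belongs to `extOne (exactStructure U) X Y`
iff every map from Y to a member of U kills it (`mem_extOne_iff`). So relative Ext¹ is the submodule
`relExt`, and injective members of U impose nothing. Every other point of the Ziegler spectrum is
some R/P^l or a P-adic completion (`IsZieglerPoint.injective_or_nonempty_iso`). Hence U may be
replaced by ℱ_L, the injectives and the completions in U (`IsZieglerClosed.exactStructure_eq`); ℰ_L
is the case without completions.

Since a nonzero scalar kills Ext¹(X, Y), scalars project onto its primary parts, and the primes can
be treated separately. The P-part is blind to R/Q^l and to Q-adic completions for Q ≠ P. For P in M,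
the maps to R/P^l with 1 ≤ l ≤ n_P detect Ext¹(X, Y/P^n Y), n = n_P, because that quotient of Y
decomposes into such cyclic modules. Right exactness of Ext¹(X, -) identifies the kernel of Ext¹(X,
Y) → Ext¹(X, Y/P^n Y) with P^n Ext¹(X, Y). Write N for the relative Ext¹ of ℰ'_A. To obtain P^n N_P
instead of N_P ∩ P^n Ext¹, one needs N_P to be a retract: it is the part induced by the torsion
summand of Y if P ∈ A, and the whole P-part otherwise (`exists_primary_retraction`).

The retraction is natural in X. Restriction Ext¹_R(X, Y) → Ext¹_R(W, Y) along W ⊆ X is onto, and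
therefore stays onto for relative Ext¹; this makes every 2-extension trivial
(`isHereditaryExact_of_extOne_surjective`).

Localisation is replaced throughout by elements s ∉ P with s P^k ⊆ rR
(`exists_mul_eq_mul_of_ne_zero`) and by local membership tests (`mem_of_forall_exists_smul_mem`). -/

namespace DedekindExact

set_option linter.unusedSectionVars false

/-! ### The exact structure axioms for ℰ^𝒰. -/

section ExactStructure

variable {R : Type u} [CommRing R] [IsNoetherianRing R]

/-- Every map from the source of `f` to a module in `U` extends along `f`. -/
def ExtendsAlong (U : ObjectProperty (ModuleCat.{u} R)) {A B : FGModuleCat.{u} R} (f : A ⟶ B) :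
    Prop :=
  ∀ N : ModuleCat.{u} R, U N → ∀ h : A.obj ⟶ N, ∃ g : B.obj ⟶ N, f.hom ≫ g = h

variable {U : ObjectProperty (ModuleCat.{u} R)}

lemma isInflation_exactStructure_iff {A B : FGModuleCat.{u} R} (f : A ⟶ B) :
    IsInflation (exactStructure U) f ↔ Mono f ∧ ExtendsAlong U f := by
  constructor
  · rintro ⟨Z, g, h, hE⟩
    exact ⟨hE.1.mono_f, hE.2⟩
  · rintro ⟨hm, hU⟩
    refine ⟨cokernel f, cokernel.π f, cokernel.condition f, ?_, hU⟩
    exact ShortComplex.ShortExact.mk' (ShortComplex.exact_of_g_is_cokernel _ (cokernelIsCokernel f))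
      hm (inferInstanceAs (Epi (cokernel.π f)))

/-- Two kernels of g are isomorphic over its source, so the extension condition may be tested on the
chosen kernel. -/
lemma isDeflation_exactStructure_iff {B Z : FGModuleCat.{u} R} (g : B ⟶ Z) :
    IsDeflation (exactStructure U) g ↔ Epi g ∧ ExtendsAlong U (kernel.ι g) := by
  constructor
  · rintro ⟨K, f, h, hE⟩
    have := hE.1.mono_f
    refine ⟨hE.1.epi_g, fun N hN a => ?_⟩
    let e : K ⟶ kernel g := kernel.lift g f h
    let e' : kernel g ⟶ K := hE.1.exact.lift (kernel.ι g) (kernel.condition g)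
    have he' : e' ≫ f = kernel.ι g := hE.1.exact.lift_f _ _
    have hid : e' ≫ e = 𝟙 _ := by
      rw [← cancel_mono (kernel.ι g), Category.assoc, kernel.lift_ι, he', Category.id_comp]
    obtain ⟨b, hb⟩ := hE.2 N hN (e.hom ≫ a)
    refine ⟨b, ?_⟩
    have h1 : (kernel.ι g).hom = e'.hom ≫ f.hom := congrArg (·.hom) he'.symm
    have h2 : e'.hom ≫ e.hom = 𝟙 _ := congrArg (·.hom) hid
    dsimp at hb
    rw [h1, Category.assoc, hb, ← Category.assoc, h2, Category.id_comp]
  · rintro ⟨he, hU⟩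
    refine ⟨kernel g, kernel.ι g, kernel.condition g, ?_, hU⟩
    exact ShortComplex.ShortExact.mk' (ShortComplex.exact_of_f_is_kernel _ (kernelIsKernel g))
      (inferInstanceAs (Mono (kernel.ι g))) he

lemma ExtendsAlong.comp {A B Z : FGModuleCat.{u} R} {f : A ⟶ B} {g : B ⟶ Z}
    (hf : ExtendsAlong U f) (hg : ExtendsAlong U g) : ExtendsAlong U (f ≫ g) := by
  intro N hN h
  obtain ⟨a, ha⟩ := hf N hN h
  obtain ⟨b, hb⟩ := hg N hN a
  exact ⟨b, by simp [hb, ha]⟩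

lemma exactStructure_shortExact_of_iso {S₁ S₂ : ShortComplex (FGModuleCat.{u} R)} (e : S₁ ≅ S₂)
    (h : exactStructure U S₁) : exactStructure U S₂ := by
  refine ⟨ShortComplex.shortExact_of_iso e h.1, fun N hN f => ?_⟩
  obtain ⟨g, hg⟩ := h.2 N hN (e.hom.τ₁.hom ≫ f)
  refine ⟨e.inv.τ₂.hom ≫ g, ?_⟩
  have h1 : S₂.f.hom ≫ e.inv.τ₂.hom = e.inv.τ₁.hom ≫ S₁.f.hom :=
    (congrArg (·.hom) e.inv.comm₁₂).symm
  have h2 : e.inv.τ₁.hom ≫ e.hom.τ₁.hom = 𝟙 _ := congrArg (fun t => t.τ₁.hom) e.inv_hom_id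
  rw [← Category.assoc, h1, Category.assoc, hg, ← Category.assoc, h2, Category.id_comp]

/-- Extend the restriction of h to ker p over B. The error of this extension vanishes on ker p, so
it descends to ker q; extending it from there and pulling back along p gives the correction. -/
lemma ExtendsAlong.kernel_comp {B Z W : FGModuleCat.{u} R} {p : B ⟶ Z} {q : Z ⟶ W} [Epi p]
    (hp : ExtendsAlong U (kernel.ι p)) (hq : ExtendsAlong U (kernel.ι q)) :
    ExtendsAlong U (kernel.ι (p ≫ q)) := by
  intro N hN h
  let j : kernel p ⟶ kernel (p ≫ q) := kernel.lift _ (kernel.ι p) (by simp)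
  have hj : j ≫ kernel.ι (p ≫ q) = kernel.ι p := kernel.lift_ι _ _ _
  let r : kernel (p ≫ q) ⟶ kernel q := kernel.lift _ (kernel.ι (p ≫ q) ≫ p) (by simp)
  have hr : r ≫ kernel.ι q = kernel.ι (p ≫ q) ≫ p := kernel.lift_ι _ _ _
  obtain ⟨a, ha⟩ := hp N hN (j.hom ≫ h)
  have hj' : j.hom ≫ (kernel.ι (p ≫ q)).hom = (kernel.ι p).hom := congrArg (·.hom) hj
  have hr' : r.hom ≫ (kernel.ι q).hom = (kernel.ι (p ≫ q)).hom ≫ p.hom := congrArg (·.hom) hr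
  -- `j` is a kernel of the epimorphism `r`
  have hpsurj : Function.Surjective p.hom.hom :=
    (ModuleCat.epi_iff_surjective _).1
      (inferInstanceAs (Epi ((forget₂ (FGModuleCat.{u} R) (ModuleCat.{u} R)).map p)))
  have hinj : ∀ {K L : FGModuleCat.{u} R} (f : K ⟶ L) [Mono f], Function.Injective f.hom.hom :=
    fun f _ => (ModuleCat.mono_iff_injective _).1
      (inferInstanceAs (Mono ((forget₂ (FGModuleCat.{u} R) (ModuleCat.{u} R)).map f)))
  have hker : ∀ {K L : FGModuleCat.{u} R} (f : K ⟶ L) (x : K), f.hom.hom x = 0 →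
      ∃ y : (kernel f : FGModuleCat.{u} R), (kernel.ι f).hom.hom y = x := by
    intro K L f x hx
    have hE : ((ShortComplex.mk (kernel.ι f) f (kernel.condition f)).map
      (forget₂ (FGModuleCat.{u} R) (ModuleCat.{u} R))).Exact :=
      (ShortComplex.exact_of_f_is_kernel (ShortComplex.mk (kernel.ι f) f (kernel.condition f))
        (kernelIsKernel f)).map _
    exact (ShortComplex.moduleCat_exact_iff _).1 hE x hx
  have hj'' : ∀ x, (kernel.ι (p ≫ q)).hom.hom (j.hom.hom x) = (kernel.ι p).hom.hom x :=
    fun x => by rw [← hj']; rfl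
  have hr'' : ∀ x, (kernel.ι q).hom.hom (r.hom.hom x) = p.hom.hom ((kernel.ι (p ≫ q)).hom.hom x) :=
    fun x => congrArg (fun t => t.hom x) hr'
  have hrs : Function.Surjective r.hom.hom := by
    intro y
    obtain ⟨x, hx⟩ := hpsurj ((kernel.ι q).hom.hom y)
    have : (p ≫ q).hom.hom x = 0 := by
      change q.hom.hom (p.hom.hom x) = 0
      rw [hx]
      exact congrArg (fun t => t.hom.hom y) (kernel.condition q)
    obtain ⟨z, hz⟩ := hker _ x this
    refine ⟨z, hinj (kernel.ι q) ?_⟩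
    rw [hr'', hz, hx]
  let S : ShortComplex (ModuleCat.{u} R) := ShortComplex.mk j.hom r.hom (by
      ext x
      apply hinj (kernel.ι q)
      change (kernel.ι q).hom.hom (r.hom.hom (j.hom.hom x)) = (kernel.ι q).hom.hom 0
      rw [hr'', hj'', map_zero]
      exact congrArg (fun t => t.hom.hom x) (kernel.condition p))
  have hS : S.Exact := by
    rw [ShortComplex.moduleCat_exact_iff]
    intro x hx
    change r.hom.hom x = 0 at hx
    have : p.hom.hom ((kernel.ι (p ≫ q)).hom.hom x) = 0 := by
      rw [← hr'', hx, map_zero]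
    obtain ⟨y, hy⟩ := hker _ _ this
    exact ⟨y, hinj (kernel.ι (p ≫ q)) (by rw [← hy]; exact hj'' y)⟩
  have : Epi S.g := (ModuleCat.epi_iff_surjective _).2 hrs
  have hzero : S.f ≫ (h - (kernel.ι (p ≫ q)).hom ≫ a) = 0 := by
    change j.hom ≫ (h - (kernel.ι (p ≫ q)).hom ≫ a) = 0
    rw [Preadditive.comp_sub, ← Category.assoc, hj', ha, sub_self]
  obtain ⟨b, hb⟩ := hq N hN (hS.desc _ hzero)
  refine ⟨a + p.hom ≫ b, ?_⟩
  have hd : r.hom ≫ hS.desc _ hzero = h - (kernel.ι (p ≫ q)).hom ≫ a := hS.g_desc _ hzero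
  rw [Preadditive.comp_add, ← Category.assoc, ← hr', Category.assoc, hb, hd]
  abel

/-- Pushouts inherit the extension property from their universal property, taken in `ModuleCat`
since N need not be finitely generated. Pullbacks inherit it because parallel maps in a pullback
square have the same kernel. -/
theorem isExactStructure_exactStructure (U : ObjectProperty (ModuleCat.{u} R)) :
    IsExactStructure (exactStructure U) where
  kernel_cokernel S hS := by
    have := hS.1.mono_f
    have := hS.1.epi_g
    exact ⟨⟨hS.1.fIsKernel⟩, ⟨hS.1.gIsCokernel⟩⟩
  iso_closed := ⟨fun e h => exactStructure_shortExact_of_iso e h⟩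
  id_inflation X := (isInflation_exactStructure_iff _).2
    ⟨inferInstance, fun N _ h => ⟨h, by simp⟩⟩
  id_deflation X := (isDeflation_exactStructure_iff _).2
    ⟨inferInstance, fun N _ h => ⟨0, by
      have h0 : (𝟙 (kernel (𝟙 X)) : _ ⟶ _) = 0 := by
        rw [← cancel_mono (kernel.ι (𝟙 X)), zero_comp, Category.id_comp, ← Category.comp_id
          (kernel.ι (𝟙 X)), kernel.condition]
      have h1 : (𝟙 (kernel (𝟙 X)) : _ ⟶ _).hom = 0 := congrArg (·.hom) h0
      rw [comp_zero, ← Category.id_comp h]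
      change 0 = (𝟙 (kernel (𝟙 X)) : _ ⟶ _).hom ≫ h
      rw [h1, zero_comp]⟩⟩
  comp_inflation f g hf hg := by
    rw [isInflation_exactStructure_iff] at *
    have := hf.1
    have := hg.1
    exact ⟨mono_comp f g, hf.2.comp hg.2⟩
  comp_deflation f g hf hg := by
    rw [isDeflation_exactStructure_iff] at *
    have := hf.1
    have := hg.1
    exact ⟨epi_comp f g, hf.2.kernel_comp hg.2⟩
  pushout_inflation i a hi := by
    rw [isInflation_exactStructure_iff] at hi
    have := hi.1
    refine ⟨pushout i a, pushout.inl i a, pushout.inr i a, IsPushout.of_hasPushout i a, ?_⟩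
    rw [isInflation_exactStructure_iff]
    refine ⟨inferInstance, fun N hN h => ?_⟩
    obtain ⟨b, hb⟩ := hi.2 N hN (a.hom ≫ h)
    have hpo := (IsPushout.of_hasPushout i a).map (forget₂ (FGModuleCat.{u} R) (ModuleCat.{u} R))
    exact ⟨hpo.desc b h hb, hpo.inr_desc b h hb⟩
  pullback_deflation p z hp := by
    rw [isDeflation_exactStructure_iff] at hp
    have := hp.1
    refine ⟨pullback p z, pullback.fst p z, pullback.snd p z, IsPullback.of_hasPullback p z, ?_⟩
    rw [isDeflation_exactStructure_iff]
    refine ⟨inferInstance, fun N hN h => ?_⟩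
    let e : kernel p ⟶ kernel (pullback.snd p z) :=
      kernel.lift _ (pullback.lift (kernel.ι p) 0 (by simp)) (pullback.lift_snd _ _ _)
    let e' : kernel (pullback.snd p z) ⟶ kernel p :=
      kernel.lift _ (kernel.ι (pullback.snd p z) ≫ pullback.fst p z)
        (by rw [Category.assoc, pullback.condition, kernel.condition_assoc, zero_comp])
    have hid : e' ≫ e = 𝟙 _ := by
      rw [← cancel_mono (kernel.ι (pullback.snd p z))]
      apply pullback.hom_ext
      · simp only [e, Category.assoc, kernel.lift_ι, pullback.lift_fst, Category.id_comp, e']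
      · simp only [e, Category.assoc, kernel.lift_ι, pullback.lift_snd, Category.id_comp, comp_zero,
          kernel.condition]
    have he' : e' ≫ kernel.ι p = kernel.ι (pullback.snd p z) ≫ pullback.fst p z :=
      kernel.lift_ι _ _ _
    obtain ⟨b, hb⟩ := hp.2 N hN (e.hom ≫ h)
    refine ⟨(pullback.fst p z).hom ≫ b, ?_⟩
    have h1 : e'.hom ≫ (kernel.ι p).hom =
      (kernel.ι (pullback.snd p z)).hom ≫ (pullback.fst p z).hom := congrArg (·.hom) he'
    have h2 : e'.hom ≫ e.hom = 𝟙 _ := congrArg (·.hom) hid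
    rw [← Category.assoc, ← h1, Category.assoc, hb, ← Category.assoc, h2, Category.id_comp]

end ExactStructure

/-! ### Relative Ext¹ and a criterion for the vanishing of Ext². -/

section RelativeExt

open Abelian ZeroObject

variable {R : Type u} [CommRing R] [IsNoetherianRing R]

/-- The short complex of modules underlying a short complex of finitely generated modules. -/
abbrev toModuleCat (S : ShortComplex (FGModuleCat.{u} R)) : ShortComplex (ModuleCat.{u} R) :=
  S.map (forget₂ (FGModuleCat.{u} R) (ModuleCat.{u} R))

lemma shortExact_toModuleCat {S : ShortComplex (FGModuleCat.{u} R)} (hS : S.ShortExact) :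
    (toModuleCat S).ShortExact :=
  hS.map_of_exact _

lemma shortExact_pushout {S : ShortComplex (FGModuleCat.{u} R)} (hS : S.ShortExact)
    {Y : FGModuleCat.{u} R} (g : S.X₁ ⟶ Y) :
    (ShortComplex.mk (pushout.inr S.f g) (pushout.desc S.g 0 (by simp))
      (pushout.inr_desc _ _ _)).ShortExact := by
  have := hS.mono_f
  have := hS.epi_g
  have hepi : Epi (pushout.desc (f := S.f) (g := g) S.g (0 : Y ⟶ S.X₃) (by simp)) := by
    have : Epi (pushout.inl S.f g ≫ pushout.desc S.g (0 : Y ⟶ S.X₃) (by simp)) := by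
      rw [pushout.inl_desc]; infer_instance
    exact epi_of_epi (pushout.inl S.f g) _
  refine ShortComplex.ShortExact.mk' (ShortComplex.exact_of_g_is_cokernel _ ?_)
    (inferInstanceAs (Mono (pushout.inr S.f g))) hepi
  refine CokernelCofork.IsColimit.ofπ _ _
    (fun k hk => hS.exact.desc (pushout.inl S.f g ≫ k) ?_) (fun k hk => ?_) (fun k hk m hm => ?_)
  · change pushout.inr S.f g ≫ k = 0 at hk
    rw [← Category.assoc, pushout.condition, Category.assoc, hk, comp_zero]
  · change pushout.inr S.f g ≫ k = 0 at hk
    apply pushout.hom_ext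
    · rw [pushout.inl_desc_assoc]
      exact hS.exact.g_desc _ _
    · rw [pushout.inr_desc_assoc, zero_comp, hk]
  · rw [← cancel_epi S.g, hS.exact.g_desc, ← hm, pushout.inl_desc_assoc]

/-- A class dies on a finite free cover of X, so it comes from a map of the kernel to Y. The pushout
along that map keeps the middle term finitely generated. -/
lemma exists_extClass_eq {X Y : FGModuleCat.{u} R} (x : ExtR X Y) :
    ∃ (Z : FGModuleCat.{u} R) (i : Y ⟶ Z) (p : Z ⟶ X) (h : i ≫ p = 0)
      (_ : (ShortComplex.mk i p h).ShortExact)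
      (hS : (toModuleCat (ShortComplex.mk i p h)).ShortExact), hS.extClass = x := by
  obtain ⟨m, π, hπ⟩ := Module.Finite.exists_fin' R X
  let F : FGModuleCat.{u} R := FGModuleCat.of R (Fin m → R)
  let q : F ⟶ X := ObjectProperty.homMk (ModuleCat.ofHom π)
  have hq : Epi q := (forget₂ (FGModuleCat.{u} R) (ModuleCat.{u} R)).epi_of_epi_map
    ((ModuleCat.epi_iff_surjective _).2 hπ)
  let S : ShortComplex (FGModuleCat.{u} R) := ShortComplex.mk (kernel.ι q) q (kernel.condition q)
  have hS : S.ShortExact :=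
    ShortComplex.ShortExact.mk' (ShortComplex.exact_of_f_is_kernel _ (kernelIsKernel q))
      (inferInstanceAs (Mono (kernel.ι q))) hq
  have hS' := shortExact_toModuleCat hS
  have hproj : Projective (ModuleCat.of R (Fin m → R)) :=
    (IsProjective.iff_projective _).1 inferInstance
  have h0 : (Ext.mk₀ (toModuleCat S).g).comp x (zero_add 1) = 0 :=
    Ext.eq_zero_of_projective (P := ModuleCat.of R (Fin m → R)) _
  obtain ⟨x₁, hx₁⟩ := Ext.contravariant_sequence_exact₃ hS' _ x h0 (add_zero 1)
  obtain ⟨g, rfl⟩ := (Ext.mk₀_bijective _ _).2 x₁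
  let g' : S.X₁ ⟶ Y := ObjectProperty.homMk g
  have hT := shortExact_pushout hS g'
  refine ⟨_, _, _, _, hT, shortExact_toModuleCat hT, ?_⟩
  let φ : S ⟶ ShortComplex.mk (pushout.inr S.f g') (pushout.desc S.g 0 (by simp))
      (pushout.inr_desc _ _ _) :=
    { τ₁ := g', τ₂ := pushout.inl S.f g', τ₃ := 𝟙 _,
      comm₁₂ := (pushout.condition).symm
      comm₂₃ := by rw [Category.comp_id]; exact pushout.inl_desc _ _ _ }
  have := ShortComplex.ShortExact.extClass_naturality hS' (shortExact_toModuleCat hT)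
    ((forget₂ (FGModuleCat.{u} R) (ModuleCat.{u} R)).mapShortComplex.map φ)
  rw [← hx₁]
  refine (this.trans ?_).symm
  exact Ext.mk₀_id_comp _

lemma exists_comp_eq_of_extClass_comp_eq_zero {S : ShortComplex (ModuleCat.{u} R)}
    (hS : S.ShortExact) {N : ModuleCat.{u} R} (f : S.X₁ ⟶ N)
    (h : hS.extClass.comp (Ext.mk₀ f) (add_zero 1) = 0) : ∃ g : S.X₂ ⟶ N, S.f ≫ g = f := by
  obtain ⟨x₂, hx₂⟩ := Ext.contravariant_sequence_exact₁ hS _ (Ext.mk₀ f) (add_zero 1) h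
  obtain ⟨g, rfl⟩ := (Ext.mk₀_bijective _ _).2 x₂
  refine ⟨g, (Ext.mk₀_bijective _ _).1 ?_⟩
  rw [← hx₂, Ext.mk₀_comp_mk₀]

lemma exists_comp_eq_of_comp_extClass_eq_zero {S : ShortComplex (ModuleCat.{u} R)}
    (hS : S.ShortExact) {N : ModuleCat.{u} R} (f : N ⟶ S.X₃)
    (h : (Ext.mk₀ f).comp hS.extClass (zero_add 1) = 0) : ∃ g : N ⟶ S.X₂, g ≫ S.g = f := by
  obtain ⟨x₂, hx₂⟩ := Ext.covariant_sequence_exact₃ _ hS (Ext.mk₀ f) (zero_add 1) h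
  obtain ⟨g, rfl⟩ := (Ext.mk₀_bijective _ _).2 x₂
  refine ⟨g, (Ext.mk₀_bijective _ _).1 ?_⟩
  rw [← hx₂, Ext.mk₀_comp_mk₀]

lemma extClass_comp_eq_zero_of_comp_eq {S : ShortComplex (ModuleCat.{u} R)}
    (hS : S.ShortExact) {N : ModuleCat.{u} R} {f : S.X₁ ⟶ N} {g : S.X₂ ⟶ N} (h : S.f ≫ g = f) :
    hS.extClass.comp (Ext.mk₀ f) (add_zero 1) = 0 := by
  rw [← h, ← Ext.mk₀_comp_mk₀, ShortComplex.ShortExact.extClass_comp_assoc]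

lemma mem_extOne_iff {U : ObjectProperty (ModuleCat.{u} R)} {X Y : FGModuleCat.{u} R}
    {x : ExtR X Y} :
    x ∈ extOne (exactStructure U) X Y ↔ ∀ N, U N → ∀ f : Y.obj ⟶ N,
      x.comp (Ext.mk₀ f) (add_zero 1) = 0 := by
  constructor
  · rintro ⟨Z, i, p, h, hE, hS, rfl⟩ N hN f
    obtain ⟨g, hg⟩ := hE.2 N hN f
    exact extClass_comp_eq_zero_of_comp_eq hS hg
  · intro H
    obtain ⟨Z, i, p, h, hE, hS, rfl⟩ := exists_extClass_eq x
    exact ⟨Z, i, p, h, ⟨hE, fun N hN f => exists_comp_eq_of_extClass_comp_eq_zero hS f (H N hN f)⟩,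
      hS, rfl⟩

/-- An equality of pullback classes is realised by a morphism of extensions. -/
lemma exists_hom_of_extClass_eq {S T : ShortComplex (ModuleCat.{u} R)} (hS : S.ShortExact)
    (hT : T.ShortExact) (a : S.X₁ ⟶ T.X₁) (c : S.X₃ ⟶ T.X₃)
    (h : hS.extClass.comp (Ext.mk₀ a) (add_zero 1) =
      (Ext.mk₀ c).comp hT.extClass (zero_add 1)) :
    ∃ b : S.X₂ ⟶ T.X₂, S.f ≫ b = a ≫ T.f ∧ S.g ≫ c = b ≫ T.g := by
  have h1 : hS.extClass.comp (Ext.mk₀ (a ≫ T.f)) (add_zero 1) = 0 := by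
    rw [← Ext.mk₀_comp_mk₀, ← Ext.comp_assoc_of_second_deg_zero, h,
      Ext.comp_assoc_of_third_deg_zero, ShortComplex.ShortExact.extClass_comp, Ext.comp_zero]
  obtain ⟨b, hb⟩ := exists_comp_eq_of_extClass_comp_eq_zero hS _ h1
  have := hS.epi_g
  have hz : S.f ≫ b ≫ T.g = 0 := by rw [← Category.assoc, hb, Category.assoc, T.zero, comp_zero]
  let c' : S.X₃ ⟶ T.X₃ := hS.exact.desc (b ≫ T.g) hz
  have hc' : S.g ≫ c' = b ≫ T.g := hS.exact.g_desc _ _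
  let φ : S ⟶ T := { τ₁ := a, τ₂ := b, τ₃ := c', comm₁₂ := hb.symm, comm₂₃ := hc'.symm }
  -- The map c' induced by b may differ from c, but both pull the class of T back to the same class.
  -- Their difference lifts to T.X₂, and subtracting this lift from b corrects it.
  have h2 : (Ext.mk₀ (c' - c)).comp hT.extClass (zero_add 1) = 0 := by
    have h3 := ShortComplex.ShortExact.extClass_naturality hS hT φ
    rw [sub_eq_add_neg, Ext.mk₀_add, Ext.add_comp, Ext.mk₀_neg, Ext.neg_comp, ← h]
    change (Ext.mk₀ φ.τ₃).comp hT.extClass (zero_add 1) + _ = 0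
    rw [← h3]
    exact add_neg_cancel _
  obtain ⟨d, hd⟩ := exists_comp_eq_of_comp_extClass_eq_zero hT _ h2
  refine ⟨b - S.g ≫ d, ?_, ?_⟩
  · rw [Preadditive.comp_sub, hb, ← Category.assoc, S.zero, zero_comp, sub_zero]
  · rw [Preadditive.sub_comp, Category.assoc, hd, Preadditive.comp_sub, hc']
    abel

/-- Lifting the left half of a 2-extension along j : W → Y₀ gives a sequence X ↣ B ↠ Y₀ in the
structure. Through it both the given extension and the trivial one map to a common third one. -/
theorem isHereditaryExact_of_extOne_surjective {U : ObjectProperty (ModuleCat.{u} R)}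
    (H : ∀ (W X Y : FGModuleCat.{u} R) (j : W ⟶ X), Mono j →
      ∀ z ∈ extOne (exactStructure U) W Y, ∃ z' ∈ extOne (exactStructure U) X Y,
        (Ext.mk₀ j.hom).comp z' (zero_add 1) = z) :
    IsHereditaryExact (exactStructure U) := by
  have hex := isExactStructure_exactStructure U
  refine ⟨hex, fun Z X => ⟨?_⟩⟩
  have hX : exactStructure U (ShortComplex.mk (𝟙 X) (0 : X ⟶ 0) comp_zero) := by
    refine ⟨ShortComplex.ShortExact.mk'
      ((ShortComplex.exact_iff_epi _ rfl).2 (inferInstanceAs (Epi (𝟙 X))))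
      (inferInstanceAs (Mono (𝟙 X))) ⟨fun _ _ _ => (isZero_zero _).eq_of_src _ _⟩, ?_⟩
    intro N _ f
    exact ⟨f, Category.id_comp f⟩
  have hZ : exactStructure U (ShortComplex.mk (0 : 0 ⟶ Z) (𝟙 Z) zero_comp) := by
    refine ⟨ShortComplex.ShortExact.mk'
      ((ShortComplex.exact_iff_mono _ rfl).2 (inferInstanceAs (Mono (𝟙 Z))))
      ⟨fun _ _ _ => (isZero_zero _).eq_of_tgt _ _⟩ (inferInstanceAs (Epi (𝟙 Z))), ?_⟩
    intro N _ f
    refine ⟨0, ?_⟩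
    have h0 : (𝟙 (0 : FGModuleCat.{u} R) : _ ⟶ _).hom = 0 :=
      congrArg (·.hom) ((isZero_zero (FGModuleCat.{u} R)).eq_of_src (𝟙 _) 0)
    rw [comp_zero, ← Category.id_comp f]
    change 0 = (𝟙 (0 : FGModuleCat.{u} R) : _ ⟶ _).hom ≫ f
    rw [h0, zero_comp]
  let T₀ : TwoExtension (exactStructure U) Z X :=
    { Y₁ := X, W := 0, Y₀ := Z, i := 𝟙 X, p := 0, j := 0, q := 𝟙 Z, ip := comp_zero,
      jq := zero_comp, left_mem := hX, right_mem := hZ }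
  have key : ∀ s : TwoExtension (exactStructure U) Z X,
      Quot.mk TwoExtension.HasMorphism s = Quot.mk TwoExtension.HasMorphism T₀ := by
    intro s
    have hl := s.left_mem
    have hr := s.right_mem
    have hl' := shortExact_toModuleCat hl.1
    obtain ⟨z', hz', hzz⟩ := H s.W s.Y₀ X s.j hr.1.mono_f hl'.extClass
      ⟨_, _, _, _, hl, hl', rfl⟩
    obtain ⟨B, i', p', h', hE, hS, rfl⟩ := hz'
    obtain ⟨b, hb₁, hb₂⟩ := exists_hom_of_extClass_eq hl' hS (𝟙 _) s.j.hom (by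
      exact (Ext.comp_mk₀_id _).trans hzz.symm)
    let b' : s.Y₁ ⟶ B := ObjectProperty.homMk b
    have hb₁' : s.i ≫ b' = i' := by
      apply ObjectProperty.hom_ext
      exact hb₁.trans (Category.id_comp _)
    have hb₂' : s.p ≫ s.j = b' ≫ p' := ObjectProperty.hom_ext _ hb₂
    have hmem : exactStructure U
        (ShortComplex.mk (biprod.inl : s.Y₀ ⟶ s.Y₀ ⊞ Z) biprod.snd biprod.inl_snd) := by
      refine ⟨(ShortComplex.Splitting.ofHasBinaryBiproduct s.Y₀ Z).shortExact, fun N _ f => ?_⟩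
      refine ⟨(biprod.fst : s.Y₀ ⊞ Z ⟶ _).hom ≫ f, ?_⟩
      have h1 : (biprod.inl : s.Y₀ ⟶ s.Y₀ ⊞ Z).hom ≫ (biprod.fst : s.Y₀ ⊞ Z ⟶ _).hom = 𝟙 _ :=
        congrArg (·.hom) (biprod.inl_fst (X := s.Y₀) (Y := Z))
      rw [← Category.assoc]
      exact (congrArg (· ≫ f) h1).trans (Category.id_comp f)
    -- The extension s maps here by (1, q) on Y₀, and `T₀` maps here by the inclusion of Z.
    let t : TwoExtension (exactStructure U) Z X :=
      { Y₁ := B, W := s.Y₀, Y₀ := s.Y₀ ⊞ Z, i := i', p := p', j := biprod.inl, q := biprod.snd,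
        ip := h', jq := biprod.inl_snd, left_mem := hE, right_mem := hmem }
    have h1 : TwoExtension.HasMorphism s t := by
      refine ⟨b', s.j, biprod.lift (𝟙 _) s.q, hb₁', hb₂', ?_, biprod.lift_snd _ _⟩
      apply biprod.hom_ext
      · simp [t]
      · simp [t, s.jq]
    have h2 : TwoExtension.HasMorphism T₀ t := by
      refine ⟨i', 0, biprod.inr, Category.id_comp _, ?_, ?_, biprod.inr_snd⟩
      · rw [comp_zero]; exact h'.symm
      · rw [zero_comp]; exact zero_comp.symm
    exact (Quot.sound h1).trans (Quot.sound h2).symm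
  intro a b
  obtain ⟨a, rfl⟩ := Quot.exists_rep a
  obtain ⟨b, rfl⟩ := Quot.exists_rep b
  exact (key a).trans (key b).symm

end RelativeExt

/-! ### Local arithmetic of a Dedekind domain and self-injectivity of R/P^l. -/

section Dedekind

variable {R : Type u} [CommRing R]

/-- If `s • x` and `P ^ n • x` are in a submodule, with `s` outside the maximal ideal `P`, then so is
`x`. -/
lemma mem_of_smul_mem_of_notMem {V : Type*} [AddCommGroup V] [Module R V] {P : Ideal R}
    [P.IsMaximal] {S : Submodule R V} {s : R} (hs : s ∉ P) {n : ℕ} {x : V} (hsx : s • x ∈ S)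
    (hP : ∀ p ∈ P ^ n, p • x ∈ S) : x ∈ S := by
  obtain ⟨a, p, hp, h⟩ := Ideal.IsMaximal.exists_inv_pow P hs n
  rw [← one_smul R x, ← h, add_smul, mul_smul]
  exact S.add_mem (S.smul_mem _ hsx) (hP p hp)

/-- Membership in a submodule is a local property. -/
lemma mem_of_forall_exists_smul_mem {V : Type*} [AddCommGroup V] [Module R V] {S : Submodule R V}
    {x : V} (h : ∀ P : MaximalSpectrum R, ∃ s ∉ P.asIdeal, s • x ∈ S) : x ∈ S := by
  let I : Ideal R := S.comap (LinearMap.toSpanSingleton R V x)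
  have hI : I = ⊤ := by
    by_contra hne
    obtain ⟨P, hP, hle⟩ := Ideal.exists_le_maximal I hne
    obtain ⟨s, hs, hsx⟩ := h ⟨P, hP⟩
    exact hs (hle hsx)
  have : (1 : R) ∈ I := hI ▸ Submodule.mem_top
  simpa [I] using this

lemma mem_primaryComponent {V : Type*} [AddCommGroup V] [Module R V] {P : Ideal R} {x : V} :
    x ∈ P.primaryComponent V ↔ ∃ n : ℕ, ∀ p ∈ P ^ n, p • x = 0 := by
  simp [Ideal.primaryComponent_mem, Submodule.mem_torsionBySet_iff]

lemma disjoint_primaryComponent {P Q : Ideal R} [P.IsMaximal] [Q.IsMaximal] (hPQ : P ≠ Q)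
    (V : Type v) [AddCommGroup V] [Module R V] :
    Disjoint (P.primaryComponent V) (Q.primaryComponent V) := by
  rw [Submodule.disjoint_def]
  intro x hx hx'
  obtain ⟨m, hm⟩ := mem_primaryComponent.1 hx
  obtain ⟨n, hn⟩ := mem_primaryComponent.1 hx'
  have hcop : IsCoprime (P ^ m) (Q ^ n) :=
    (Ideal.isCoprime_of_isMaximal hPQ).pow
  obtain ⟨a, ha, b, hb, hab⟩ := Ideal.isCoprime_iff_exists.1 hcop
  rw [← one_smul R x, ← hab, add_smul, hm a ha, hn b hb, add_zero]

/-- Transfers the divisibility s I ⊆ aR from ideals to modules: elements of IQ become divisible by a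
after multiplication by s. -/
lemma exists_smul_eq_smul_of_mem_smul {V : Type*} [AddCommGroup V] [Module R V] {I : Ideal R}
    {s a : R} (h : ∀ x ∈ I, ∃ t, s * x = a * t) {Q : Submodule R V} {w : V}
    (hw : w ∈ I • Q) : ∃ w' ∈ Q, s • w = a • w' := by
  refine Submodule.smul_induction_on hw (fun p hp v hv => ?_) ?_
  · obtain ⟨t, ht⟩ := h p hp
    exact ⟨t • v, Q.smul_mem _ hv, by rw [← mul_smul, ht, mul_smul]⟩
  · rintro x y ⟨x', hx', hx⟩ ⟨y', hy', hy⟩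
    exact ⟨x' + y', add_mem hx' hy', by rw [smul_add, hx, hy, smul_add]⟩

variable [IsDedekindDomain R]

/-- Write rR = P^k I with P not dividing I and take s in I outside P. This is the denominator-free
form of rR_P = P^k R_P. -/
lemma exists_mul_eq_mul_of_ne_zero (P : Ideal R) [P.IsMaximal] {r : R} (hr : r ≠ 0) :
    ∃ k, r ∈ P ^ k ∧ ∃ s ∉ P, ∀ x ∈ P ^ k, ∃ t, s * x = r * t := by
  have hfin : FiniteMultiplicity P (Ideal.span {r}) := by
    apply FiniteMultiplicity.of_not_isUnit
    · rw [Ideal.isUnit_iff]; exact Ideal.IsMaximal.ne_top ‹_›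
    · simpa using hr
  obtain ⟨I, hI, hdvd⟩ := hfin.exists_eq_pow_mul_and_not_dvd
  rw [Ideal.dvd_iff_le] at hdvd
  obtain ⟨s, hs, hsP⟩ := SetLike.not_le_iff_exists.1 hdvd
  refine ⟨multiplicity P (Ideal.span {r}), ?_, s, hsP, fun x hx => ?_⟩
  · have h := Ideal.mem_span_singleton_self r
    rw [hI] at h
    exact Ideal.mul_le_left h
  · have : x * s ∈ Ideal.span {r} := by rw [hI]; exact Ideal.mul_mem_mul hx hs
    obtain ⟨t, ht⟩ := Ideal.mem_span_singleton'.1 this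
    exact ⟨t, by rw [mul_comm s, ← ht, mul_comm]⟩

lemma exists_mul_eq_mul_of_mem_pow (P : Ideal R) [P.IsMaximal] {a : R} {k : ℕ}
    (ha' : a ∉ P ^ (k + 1)) : ∃ s ∉ P, ∀ x ∈ P ^ k, ∃ t, s * x = a * t := by
  have h0 : a ≠ 0 := fun h => ha' (h ▸ zero_mem _)
  obtain ⟨j, hj, s, hs, h⟩ := exists_mul_eq_mul_of_ne_zero P h0
  refine ⟨s, hs, fun x hx => h x (Ideal.pow_le_pow_right ?_ hx)⟩
  by_contra hlt
  exact ha' (Ideal.pow_le_pow_right (by omega) hj)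

lemma eq_pow_of_pow_le {P : Ideal R} [hP : P.IsMaximal] {J : Ideal R} {l : ℕ} (h : P ^ l ≤ J) :
    ∃ i ≤ l, J = P ^ i := by
  by_cases h0 : P = ⊥
  · subst h0
    by_cases hJ : J = ⊤
    · exact ⟨0, Nat.zero_le _, by simpa using hJ⟩
    · rcases Nat.eq_zero_or_pos l with rfl | hl
      · exact absurd (top_le_iff.1 (by simpa using h)) hJ
      · exact ⟨1, hl, by rw [pow_one]; exact (hP.eq_of_le hJ bot_le).symm⟩
  · have := Ideal.prime_of_isPrime h0 hP.isPrime
    obtain ⟨i, hi, hJ⟩ := (dvd_prime_pow this l).1 (Ideal.dvd_iff_le.2 h)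
    exact ⟨i, hi, associated_iff_eq.1 hJ⟩

/-- Any a in P^i outside P^(i+1) works: the ideal (a) + P^l contains P^l, hence is a power of P, and
its exponent cannot exceed i. -/
lemma exists_pow_eq_span_sup (P : Ideal R) [hP : P.IsMaximal] {i l : ℕ} (hil : i ≤ l) :
    ∃ a ∈ P ^ i, P ^ i = Ideal.span {a} ⊔ P ^ l := by
  by_cases h0 : P = ⊥
  · subst h0
    rcases Nat.eq_zero_or_pos i with rfl | hi
    · exact ⟨1, by simp, by simp⟩
    · refine ⟨0, zero_mem _, ?_⟩
      simp [hi.ne', (hi.trans_le hil).ne']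
  · obtain ⟨a, ha, ha'⟩ := SetLike.exists_of_lt (Ideal.pow_succ_lt_pow h0 i)
    refine ⟨a, ha, le_antisymm ?_ (sup_le ((Ideal.span_singleton_le_iff_mem _).2 ha)
      (Ideal.pow_le_pow_right hil))⟩
    obtain ⟨j, hj, h⟩ := eq_pow_of_pow_le (P := P) (J := Ideal.span {a} ⊔ P ^ l) le_sup_right
    rw [h]
    refine Ideal.pow_le_pow_right ?_
    by_contra hlt
    refine ha' (Ideal.pow_le_pow_right (by omega : i + 1 ≤ j) ?_)
    rw [← h]
    exact Ideal.mem_sup_left (Ideal.mem_span_singleton_self a)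

/-- The quotients `R ⧸ P ^ l` are self-injective. -/
lemma baer_quotient_pow (P : Ideal R) [hP : P.IsMaximal] (l : ℕ) :
    Module.Baer (R ⧸ P ^ l) (R ⧸ P ^ l) := by
  intro J g
  obtain ⟨i, hil, hi⟩ := eq_pow_of_pow_le (P := P) (J := J.comap (Ideal.Quotient.mk (P ^ l)))
    (l := l) (fun x hx => by
      rw [Ideal.mem_comap, Ideal.Quotient.eq_zero_iff_mem.2 hx]; exact zero_mem _)
  have hmem : ∀ x, Ideal.Quotient.mk (P ^ l) x ∈ J ↔ x ∈ P ^ i := fun x => by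
    rw [← hi, Ideal.mem_comap]
  by_cases hle : P ^ i ≤ P ^ l
  · refine ⟨0, fun x hx => ?_⟩
    obtain ⟨x, rfl⟩ := Ideal.Quotient.mk_surjective x
    have h0 : (⟨_, hx⟩ : J) = 0 :=
      Subtype.ext (Ideal.Quotient.eq_zero_iff_mem.2 (hle ((hmem x).1 hx)))
    rw [h0, map_zero, LinearMap.zero_apply]
  obtain ⟨a, ha, hspan⟩ := exists_pow_eq_span_sup P hil
  obtain ⟨c, hc⟩ := Ideal.Quotient.mk_surjective (g ⟨_, (hmem a).2 ha⟩)
  -- As P^(l-i) a ⊆ P^l, the value c of g at a is killed by P^(l-i) modulo P^l. Cancelling this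
  -- ideal puts c in P^i = (a) + P^l, so g is multiplication by the quotient d of c by a.
  have hmul : ∀ r ∈ P ^ (l - i), r * c ∈ P ^ l := by
    intro r hr
    have h1 : r * a ∈ P ^ l := by
      rw [← Nat.sub_add_cancel hil, pow_add]; exact Ideal.mul_mem_mul hr ha
    have h2 : Ideal.Quotient.mk (P ^ l) r • (⟨_, (hmem a).2 ha⟩ : J) = 0 :=
      Subtype.ext (by
        change Ideal.Quotient.mk (P ^ l) r * Ideal.Quotient.mk (P ^ l) a = 0
        rw [← map_mul]; exact Ideal.Quotient.eq_zero_iff_mem.2 h1)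
    have h3 := congrArg g h2
    rw [map_smul, map_zero, ← hc, smul_eq_mul, ← map_mul] at h3
    exact Ideal.Quotient.eq_zero_iff_mem.1 h3
  have hc' : c ∈ P ^ i := by
    by_cases h0 : P = ⊥
    · rcases Nat.eq_zero_or_pos i with rfl | hi'
      · simp
      · exact absurd (by simp [h0, hi'.ne']) hle
    · have h1 : P ^ (l - i) * Ideal.span {c} ≤ P ^ (l - i) * P ^ i := by
        rw [← pow_add, Nat.sub_add_cancel hil, Ideal.mul_le]
        intro r hr s hs
        obtain ⟨t, rfl⟩ := Ideal.mem_span_singleton'.1 hs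
        rw [mul_left_comm]
        exact Ideal.mul_mem_left _ _ (hmul r hr)
      rw [← Ideal.dvd_iff_le, mul_dvd_mul_iff_left (pow_ne_zero _ h0), Ideal.dvd_iff_le,
        Ideal.span_singleton_le_iff_mem] at h1
      exact h1
  have hdec : ∀ x ∈ P ^ i, ∃ d, Ideal.Quotient.mk (P ^ l) x =
      Ideal.Quotient.mk (P ^ l) d * Ideal.Quotient.mk (P ^ l) a := by
    intro x hx
    rw [hspan] at hx
    obtain ⟨y, hy, z, hz, rfl⟩ := Submodule.mem_sup.1 hx
    obtain ⟨d, rfl⟩ := Ideal.mem_span_singleton'.1 hy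
    exact ⟨d, by rw [map_add, map_mul, Ideal.Quotient.eq_zero_iff_mem.2 hz, add_zero]⟩
  obtain ⟨d, hd⟩ := hdec c hc'
  refine ⟨LinearMap.lsmul _ _ (Ideal.Quotient.mk (P ^ l) d), fun x hx => ?_⟩
  obtain ⟨x, rfl⟩ := Ideal.Quotient.mk_surjective x
  obtain ⟨e, he⟩ := hdec x ((hmem x).1 hx)
  have hx' : (⟨_, hx⟩ : J) = Ideal.Quotient.mk (P ^ l) e • ⟨_, (hmem a).2 ha⟩ :=
    Subtype.ext he
  rw [hx', map_smul, ← hc, hd, he]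
  change Ideal.Quotient.mk (P ^ l) d * _ = _ * _
  ring

/-- An element whose annihilator modulo `P ^ l` is `P ^ l` is mapped to `1` by some functional with
values in `R ⧸ P ^ l`. -/
lemma exists_linearMap_quotient_pow_eq_one (P : Ideal R) [hP : P.IsMaximal] (l : ℕ)
    {V : Type v} [AddCommGroup V] [Module R V] (y : V)
    (hy : ∀ r : R, r • y ∈ (P ^ l • ⊤ : Submodule R V) → r ∈ P ^ l) :
    ∃ f : V →ₗ[R] R ⧸ P ^ l, f y = 1 := by
  let π := (P ^ l • ⊤ : Submodule R V).mkQ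
  let i : (R ⧸ P ^ l) →ₗ[R ⧸ P ^ l] V ⧸ (P ^ l • ⊤ : Submodule R V) :=
    LinearMap.toSpanSingleton _ _ (π y)
  have hi : Function.Injective i := by
    rw [injective_iff_map_eq_zero]
    intro a ha
    obtain ⟨r, rfl⟩ := Ideal.Quotient.mk_surjective a
    have h1 : π (r • y) = 0 := ha
    exact Ideal.Quotient.eq_zero_iff_mem.2 (hy r ((Submodule.Quotient.mk_eq_zero _).1 h1))
  obtain ⟨h, hh⟩ := (baer_quotient_pow P l).extension_property i hi LinearMap.id
  refine ⟨(h.restrictScalars R).comp π, ?_⟩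
  have := LinearMap.congr_fun hh 1
  simpa [i] using this

/-- On a module with nonzero annihilator, the projection onto the `P`-primary component is the
multiplication by a suitable scalar. -/
lemma exists_smul_eq_primary_projection (P : Ideal R) [P.IsMaximal] {r : R} (hr : r ≠ 0) :
    ∃ c : R, 1 - c ∈ P ∧ ∀ {V : Type v} [AddCommGroup V] [Module R V], (∀ z : V, r • z = 0) →
      (∀ z : V, c • z ∈ P.primaryComponent V) ∧ ∀ z ∈ P.primaryComponent V, c • z = z := by
  obtain ⟨k, -, s, hs, h⟩ := exists_mul_eq_mul_of_ne_zero P hr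
  -- The exponent k + 1 puts p = 1 - a s inside P even if k = 0.
  obtain ⟨a, p, hp, hap⟩ := Ideal.IsMaximal.exists_inv_pow P hs (k + 1)
  have hcp : 1 - a * s = p := by rw [← hap]; ring
  refine ⟨a * s, ?_, fun {V} _ _ hV => ?_⟩
  · rw [hcp]; exact Ideal.pow_le_self (by omega) hp
  have hz : ∀ q ∈ P ^ k, ∀ z : V, (s * q) • z = 0 := by
    intro q hq z
    obtain ⟨t, ht⟩ := h q hq
    rw [ht, mul_smul, hV]
  refine ⟨fun z => mem_primaryComponent.2 ⟨k, fun q hq => ?_⟩, fun z hzP => ?_⟩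
  · rw [← mul_smul, show q * (a * s) = a * (s * q) by ring, mul_smul, hz q hq, smul_zero]
  · obtain ⟨n, hn⟩ := mem_primaryComponent.1 hzP
    have hpz : p • z ∈ (⊥ : Submodule R V) := by
      refine mem_of_smul_mem_of_notMem hs (n := n) ?_ fun q hq => ?_
      · rw [← mul_smul, hz p (Ideal.pow_le_pow_right (Nat.le_succ k) hp)]; exact zero_mem _
      · rw [smul_comm, hn q hq, smul_zero]; exact zero_mem _
    have := congrArg (· • z) hap
    simpa [add_smul, (Submodule.mem_bot R).1 hpz] using this

end Dedekind

/-! ### Linear maps between Ext¹ modules. -/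

section ExtLinear

open Abelian

variable {R : Type u} [CommRing R]

/-- `Ext¹(X, f)`, as a linear map. -/
noncomputable def extMap (X : ModuleCat.{u} R) {Y Z : ModuleCat.{u} R} (f : Y ⟶ Z) :
    Ext X Y 1 →ₗ[R] Ext X Z 1 where
  toFun x := x.comp (Ext.mk₀ f) (add_zero 1)
  map_add' _ _ := Ext.add_comp _ _ _ _
  map_smul' _ _ := Ext.smul_comp _ _ _ _

/-- `Ext¹(j, Y)`, as a linear map. -/
noncomputable def extComap {W X : ModuleCat.{u} R} (j : W ⟶ X) (Y : ModuleCat.{u} R) :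
    Ext X Y 1 →ₗ[R] Ext W Y 1 where
  toFun x := (Ext.mk₀ j).comp x (zero_add 1)
  map_add' _ _ := Ext.comp_add _ _ _ _
  map_smul' _ _ := Ext.comp_smul _ _ _ _

lemma extMap_apply {X Y Z : ModuleCat.{u} R} (f : Y ⟶ Z) (x : Ext X Y 1) :
    extMap X f x = x.comp (Ext.mk₀ f) (add_zero 1) := rfl

lemma extComap_apply {W X Y : ModuleCat.{u} R} (j : W ⟶ X) (x : Ext X Y 1) :
    extComap j Y x = (Ext.mk₀ j).comp x (zero_add 1) := rfl

variable {W X Y Z T : ModuleCat.{u} R}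

lemma extMap_id (x : Ext X Y 1) : extMap X (𝟙 Y) x = x := Ext.comp_mk₀_id x

lemma extMap_comp (f : Y ⟶ Z) (g : Z ⟶ T) (x : Ext X Y 1) :
    extMap X (f ≫ g) x = extMap X g (extMap X f x) := by
  rw [extMap_apply, extMap_apply, extMap_apply, Ext.comp_assoc_of_third_deg_zero,
    Ext.mk₀_comp_mk₀]

lemma extMap_zero (x : Ext X Y 1) : extMap X (0 : Y ⟶ Z) x = 0 := by
  rw [extMap_apply, Ext.mk₀_zero, Ext.comp_zero]

lemma extMap_add (f g : Y ⟶ Z) (x : Ext X Y 1) :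
    extMap X (f + g) x = extMap X f x + extMap X g x := by
  rw [extMap_apply, Ext.mk₀_add, Ext.comp_add]; rfl

lemma extMap_sum {ι : Type*} (s : Finset ι) (f : ι → (Y ⟶ Z)) (x : Ext X Y 1) :
    extMap X (∑ i ∈ s, f i) x = ∑ i ∈ s, extMap X (f i) x := by
  classical
  induction s using Finset.induction_on with
  | empty => rw [Finset.sum_empty, Finset.sum_empty, extMap_zero]
  | insert a s ha ih => rw [Finset.sum_insert ha, Finset.sum_insert ha, extMap_add, ih]

lemma extMap_smul (r : R) (f : Y ⟶ Z) (x : Ext X Y 1) :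
    extMap X (r • f) x = r • extMap X f x := by
  rw [extMap_apply, Ext.mk₀_smul, Ext.comp_smul]; rfl

lemma extComap_extMap (j : W ⟶ X) (f : Y ⟶ Z) (x : Ext X Y 1) :
    extComap j Z (extMap X f x) = extMap W f (extComap j Y x) := by
  rw [extMap_apply, extMap_apply, extComap_apply, extComap_apply,
    Ext.comp_assoc_of_third_deg_zero]

lemma extComap_comp (i : T ⟶ W) (j : W ⟶ X) (x : Ext X Y 1) :
    extComap (i ≫ j) Y x = extComap i Y (extComap j Y x) := by
  rw [extComap_apply, extComap_apply, extComap_apply, ← Ext.mk₀_comp_mk₀]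
  exact Ext.comp_assoc_of_second_deg_zero _ _ _ _

lemma extComap_smul_id (r : R) (x : Ext X Y 1) : extComap (r • 𝟙 X) Y x = r • x := by
  rw [extComap_apply, Ext.mk₀_smul, Ext.smul_comp, Ext.mk₀_id_comp]

lemma extMap_eq_zero_of_injective [Injective Z] (f : Y ⟶ Z) (x : Ext X Y 1) :
    extMap X f x = 0 :=
  Ext.eq_zero_of_injective _

lemma eq_zero_of_module_projective [Module.Projective R X] (x : Ext X Y 1) : x = 0 := by
  have : Projective X := (IsProjective.iff_projective X).1 inferInstance
  exact Ext.eq_zero_of_projective x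

/-- The classes in `Ext¹(X, Y)` killed by all maps from `Y` to modules in `U`. -/
noncomputable def relExt (U : ObjectProperty (ModuleCat.{u} R)) (X Y : ModuleCat.{u} R) :
    Submodule R (Ext X Y 1) where
  carrier := {x | ∀ N, U N → ∀ f : Y ⟶ N, extMap X f x = 0}
  add_mem' hx hy N hN f := by rw [map_add, hx N hN, hy N hN, add_zero]
  zero_mem' N hN f := map_zero _
  smul_mem' r x hx N hN f := by rw [map_smul, hx N hN, smul_zero]

lemma mem_relExt {U : ObjectProperty (ModuleCat.{u} R)} {x : Ext X Y 1} :
    x ∈ relExt U X Y ↔ ∀ N, U N → ∀ f : Y ⟶ N, extMap X f x = 0 := Iff.rfl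

lemma relExt_sup (U V : ObjectProperty (ModuleCat.{u} R)) :
    relExt (U ⊔ V) X Y = relExt U X Y ⊓ relExt V X Y := by
  ext x
  rw [Submodule.mem_inf, mem_relExt, mem_relExt, mem_relExt]
  exact ⟨fun h => ⟨fun N hN => h N (Or.inl hN), fun N hN => h N (Or.inr hN)⟩,
    fun h N hN => hN.elim (h.1 N) (h.2 N)⟩

lemma extMap_eq_zero_of_iso (e : Z ≅ T) {x : Ext X Y 1} (h : ∀ f : Y ⟶ T, extMap X f x = 0)
    (f : Y ⟶ Z) : extMap X f x = 0 := by
  have : f = (f ≫ e.hom) ≫ e.inv := by simp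
  rw [this, extMap_comp, h, map_zero]

lemma extOne_eq_relExt [IsNoetherianRing R] (U : ObjectProperty (ModuleCat.{u} R))
    (X Y : FGModuleCat.{u} R) :
    extOne (exactStructure U) X Y = (relExt U X.obj Y.obj : Set (ExtR X Y)) := by
  ext x
  exact mem_extOne_iff

end ExtLinear

/-! ### Consequences of global dimension at most one. -/

section ExtDedekind

open Abelian

variable {R : Type u} [CommRing R] [IsDedekindDomain R]

instance projective_of_finite_of_isTorsionFree (V : Type v) [AddCommGroup V] [Module R V]
    [Module.Finite R V] [Module.IsTorsionFree R V] : Module.Projective R V :=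
  have := Module.finitePresentation_of_finite R V
  Module.Flat.projective_of_finitePresentation

/-- The kernel of a finite free cover is finitely generated and torsion-free, hence projective. -/
lemma hasProjectiveDimensionLT_two (X : ModuleCat.{u} R) [Module.Finite R X] :
    HasProjectiveDimensionLT X 2 := by
  obtain ⟨m, π, hπ⟩ := Module.Finite.exists_fin' R X
  have hS := LinearMap.shortExact_shortComplexKer hπ
  have h1 : Projective (ModuleCat.of R (LinearMap.ker π)) :=
    (IsProjective.iff_projective _).1 inferInstance
  have h2 : Projective (ModuleCat.of R (Fin m → R)) :=
    (IsProjective.iff_projective _).1 inferInstance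
  have h1' : HasProjectiveDimensionLT (ModuleCat.of R (LinearMap.ker π)) 1 := inferInstance
  have h2' : HasProjectiveDimensionLT (ModuleCat.of R (Fin m → R)) 2 := inferInstance
  exact hS.hasProjectiveDimensionLT_X₃ 1 h1' h2'

lemma extMap_surjective (X : ModuleCat.{u} R) [Module.Finite R X] {Y Z : ModuleCat.{u} R}
    (f : Y ⟶ Z) (hf : Function.Surjective f.hom) : Function.Surjective (extMap X f) := by
  intro z
  have hS := LinearMap.shortExact_shortComplexKer hf
  have := hasProjectiveDimensionLT_two X
  obtain ⟨x, hx⟩ := Ext.covariant_sequence_exact₃ X hS z (rfl : 1 + 1 = 2)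
    (Ext.eq_zero_of_hasProjectiveDimensionLT _ 2 le_rfl)
  exact ⟨x, hx⟩

lemma extComap_surjective {W X : ModuleCat.{u} R} [Module.Finite R X] (j : W ⟶ X)
    (hj : Function.Injective j.hom) (Y : ModuleCat.{u} R) :
    Function.Surjective (extComap j Y) := by
  intro z
  let S : ShortComplex (ModuleCat.{u} R) :=
    { X₁ := W, X₂ := X, X₃ := ModuleCat.of R (X ⧸ LinearMap.range j.hom), f := j,
      g := ModuleCat.ofHom (LinearMap.range j.hom).mkQ
      zero := by
        ext x
        exact (Submodule.Quotient.mk_eq_zero _).2 (LinearMap.mem_range_self _ _) }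
  have hS : S.ShortExact := ModuleCat.shortComplex_shortExact S
    (fun x => Submodule.Quotient.mk_eq_zero _) hj (Submodule.mkQ_surjective _)
  have : HasProjectiveDimensionLT S.X₃ 2 :=
    hasProjectiveDimensionLT_two (ModuleCat.of R (X ⧸ LinearMap.range j.hom))
  obtain ⟨x, hx⟩ := Ext.contravariant_sequence_exact₁ hS Y z (rfl : 1 + 1 = 2)
    (Ext.eq_zero_of_hasProjectiveDimensionLT _ 2 le_rfl)
  exact ⟨x, hx⟩

/-- If r kills the torsion of X, multiplication by r on X factors through the quotient by its
torsion, which is projective and has no Ext¹. -/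
lemma exists_ne_zero_smul_ext_eq_zero (X : ModuleCat.{u} R) [Module.Finite R X] :
    ∃ r : R, r ≠ 0 ∧ ∀ (Y : ModuleCat.{u} R) (x : Ext X Y 1), r • x = 0 := by
  let t := Submodule.torsion R X
  obtain ⟨r, hr, hr'⟩ := Submodule.annihilator_top_inter_nonZeroDivisors
    (Submodule.torsion_isTorsion (R := R) (M := X))
  refine ⟨r, nonZeroDivisors.ne_zero hr', fun Y x => ?_⟩
  have hker : t ≤ LinearMap.ker (r • (LinearMap.id : X →ₗ[R] X)) := by
    intro y hy
    have h := Submodule.mem_annihilator.1 hr (⟨y, hy⟩ : t) Submodule.mem_top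
    exact congrArg Subtype.val h
  let q : X ⟶ ModuleCat.of R (X ⧸ t) := ModuleCat.ofHom t.mkQ
  let h : ModuleCat.of R (X ⧸ t) ⟶ X := ModuleCat.ofHom (t.liftQ _ hker)
  have hqh : q ≫ h = r • 𝟙 X := by
    ext y
    rfl
  have : Module.Projective R (ModuleCat.of R (X ⧸ t)) :=
    inferInstanceAs (Module.Projective R (X ⧸ t))
  rw [← extComap_smul_id, ← hqh, extComap_comp, eq_zero_of_module_projective (extComap h Y x),
    map_zero]

/-- The kernel of `Ext¹(X, Y) ⟶ Ext¹(X, Y ⧸ I Y)` is `I Ext¹(X, Y)`. -/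
lemma mem_smul_top_of_extMap_mkQ_eq_zero (I : Ideal R) {X Y : ModuleCat.{u} R}
    [Module.Finite R X] (x : Ext X Y 1)
    (hx : extMap X (ModuleCat.ofHom (I • ⊤ : Submodule R Y).mkQ) x = 0) :
    x ∈ (I • ⊤ : Submodule R (Ext X Y 1)) := by
  obtain ⟨n, a, ha⟩ := Submodule.fg_iff_exists_fin_generating_family.1 (IsNoetherian.noetherian I)
  have hmem : ∀ i, a i ∈ I := fun i => ha ▸ Submodule.subset_span (Set.mem_range_self i)
  let S := LinearMap.shortComplexKer (I • ⊤ : Submodule R Y).mkQ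
  have hS : S.ShortExact := LinearMap.shortExact_shortComplexKer (Submodule.mkQ_surjective _)
  obtain ⟨x₁, hx₁⟩ := Ext.covariant_sequence_exact₂ X hS x hx
  -- Generators a_i of I give a surjection Y^n → IY. The class x comes from Ext¹(X, IY), hence from
  -- Ext¹(X, Y^n), where the map to Ext¹(X, Y) visibly lands in I Ext¹(X, Y).
  let φ : (Fin n → Y) →ₗ[R] Y := ∑ i, a i • LinearMap.proj i
  have hφ : ∀ y, φ y = ∑ i, a i • y i := fun y => by simp [φ]
  have hφker : ∀ y, φ y ∈ LinearMap.ker (I • ⊤ : Submodule R Y).mkQ := by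
    intro y
    rw [Submodule.ker_mkQ, hφ]
    exact Submodule.sum_mem _ fun i _ => Submodule.smul_mem_smul (hmem i) Submodule.mem_top
  let ψ : ModuleCat.of R (Fin n → Y) ⟶ S.X₁ := ModuleCat.ofHom (φ.codRestrict _ hφker)
  have hψ : Function.Surjective ψ.hom := by
    rintro ⟨y, hy⟩
    rw [Submodule.ker_mkQ] at hy
    have : y ∈ LinearMap.range φ := by
      refine Submodule.smul_induction_on hy (fun r hr y _ => ?_) fun _ _ => Submodule.add_mem _
      rw [← ha] at hr
      obtain ⟨c, rfl⟩ := (Submodule.mem_span_range_iff_exists_fun R).1 hr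
      refine ⟨fun i => c i • y, ?_⟩
      rw [hφ, Finset.sum_smul]
      exact Finset.sum_congr rfl fun i _ => by rw [smul_eq_mul, mul_comm, mul_smul]
    obtain ⟨z, hz⟩ := this
    exact ⟨z, Subtype.ext hz⟩
  obtain ⟨w, rfl⟩ := extMap_surjective X ψ hψ x₁
  have hcomp : ψ ≫ S.f = ∑ i, a i • (ModuleCat.ofHom (LinearMap.proj i) :
      ModuleCat.of R (Fin n → Y) ⟶ Y) := by
    ext y
    simp only [ModuleCat.hom_sum, ModuleCat.hom_smul]
    rfl
  rw [← hx₁]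
  change extMap X S.f (extMap X ψ w) ∈ _
  rw [← extMap_comp, hcomp, extMap_sum]
  refine Submodule.sum_mem _ fun i _ => ?_
  rw [extMap_smul]
  exact Submodule.smul_mem_smul (hmem i) Submodule.mem_top

end ExtDedekind

/-! ### Scalars acting on adic completions. -/

section AdicCompletion

variable {R : Type u} [CommRing R] (P : Ideal R) [P.IsMaximal]
  {V : Type v} [AddCommGroup V] [Module R V]

lemma adicCompletion_smul_injective {a : R} (ha : a ∉ P) {z : AdicCompletion P V}
    (h : a • z = 0) : z = 0 := by
  ext n
  have h1 : a • z.val n = 0 := congrArg (fun t => t.val n) h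
  obtain ⟨y, hy⟩ := Submodule.mkQ_surjective _ (z.val n)
  rw [← hy, ← map_smul] at h1
  rw [← hy]
  refine (Submodule.Quotient.mk_eq_zero _).2 ?_
  exact mem_of_smul_mem_of_notMem ha ((Submodule.Quotient.mk_eq_zero _).1 h1)
    fun p hp => Submodule.smul_mem_smul hp Submodule.mem_top

/-- The inverse is built levelwise from inverses u n of a modulo P^n; uniqueness of inverses makes
the levels compatible. -/
lemma adicCompletion_smul_surjective {a : R} (ha : a ∉ P) (z : AdicCompletion P V) :
    ∃ w : AdicCompletion P V, a • w = z := by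
  have hu : ∀ n, ∃ u, ∃ p ∈ P ^ n, u * a + p = 1 := fun n =>
    Ideal.IsMaximal.exists_inv_pow P ha n
  choose u p hp hup using hu
  have hcancel : ∀ n (y : V ⧸ (P ^ n • ⊤ : Submodule R V)) (m : ℕ), n ≤ m →
      (u m * a) • y = y := by
    intro n y m hnm
    obtain ⟨y, rfl⟩ := Submodule.mkQ_surjective _ y
    have h1 : (p m) • (P ^ n • ⊤ : Submodule R V).mkQ y = 0 := by
      rw [← map_smul]
      exact (Submodule.Quotient.mk_eq_zero _).2 (Submodule.smul_mem_smul
        (Ideal.pow_le_pow_right hnm (hp m)) Submodule.mem_top)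
    have h2 := congrArg (· • (P ^ n • ⊤ : Submodule R V).mkQ y) (hup m)
    simpa only [add_smul, one_smul, h1, add_zero] using h2
  refine ⟨⟨fun n => u n • z.val n, fun {m n} hmn => ?_⟩, ?_⟩
  · change AdicCompletion.transitionMap P V hmn (u n • z.val n) = u m • z.val m
    rw [map_smul, z.property hmn]
    calc u n • z.val m = u n • ((u m * a) • z.val m) := by rw [hcancel m (z.val m) m le_rfl]
      _ = u m • ((u n * a) • z.val m) := by
        rw [← mul_smul, ← mul_smul]
        congr 1
        ring
      _ = u m • z.val m := by rw [hcancel m (z.val m) n hmn]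
  · ext n
    change a • u n • z.val n = z.val n
    rw [← mul_smul, mul_comm, hcancel n _ n le_rfl]

variable [IsDedekindDomain R]

-- Dividing by r costs only a fixed number k of steps in the P-adic filtration of a torsion-free
-- module. Torsion-freeness thus passes to the completion.
variable (V) in
lemma exists_forall_smul_mem_pow_smul_top {r : R} (hr : r ≠ 0) [Module.IsTorsionFree R V] :
    ∃ k, r ∈ P ^ k ∧ ∀ m (y : V), r • y ∈ (P ^ (m + k) • ⊤ : Submodule R V) →
      y ∈ (P ^ m • ⊤ : Submodule R V) := by
  obtain ⟨k, hk, s, hs, h⟩ := exists_mul_eq_mul_of_ne_zero P hr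
  refine ⟨k, hk, fun m y hy => ?_⟩
  rw [add_comm, pow_add, mul_smul] at hy
  obtain ⟨w', hw', h1⟩ := exists_smul_eq_smul_of_mem_smul h hy
  rw [smul_comm] at h1
  have h2 : s • y = w' := smul_right_injective V hr h1
  exact mem_of_smul_mem_of_notMem hs (h2 ▸ hw')
    fun p hp => Submodule.smul_mem_smul hp Submodule.mem_top

instance adicCompletion_isTorsionFree [Module.IsTorsionFree R V] :
    Module.IsTorsionFree R (AdicCompletion P V) := by
  rw [Module.isTorsionFree_iff_smul_eq_zero]
  intro r z h
  by_contra! hne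
  obtain ⟨k, -, hk⟩ := exists_forall_smul_mem_pow_smul_top P V hne.1
  apply hne.2
  ext m
  obtain ⟨y, hy⟩ := Submodule.mkQ_surjective _ (z.val (m + k))
  have h1 : r • z.val (m + k) = 0 := congrArg (fun t => t.val (m + k)) h
  rw [← hy, ← map_smul] at h1
  have h2 := hk m y ((Submodule.Quotient.mk_eq_zero _).1 h1)
  have h3 := z.property (Nat.le_add_right m k)
  rw [← hy] at h3
  rw [← h3]
  exact (Submodule.Quotient.mk_eq_zero _).2 h2

end AdicCompletion

/-! ### Detecting classes by maps to cyclic modules. -/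

section Detection

open Abelian

variable {R : Type u} [CommRing R] [IsDedekindDomain R]

/-- Over `R ⧸ P ^ n`, classes in `Ext¹` are detected by maps to cyclic modules. -/
lemma eq_zero_of_extMap_quotient_pow_eq_zero (P : Ideal R) [P.IsMaximal] (n : ℕ)
    {X : ModuleCat.{u} R} (Y : ModuleCat.{u} R) [Module.Finite R Y]
    (hY : ∀ p ∈ P ^ n, ∀ y : Y, p • y = 0) (x : Ext X Y 1)
    (hx : ∀ l ∈ Set.Icc 1 n, ∀ f : Y ⟶ ModuleCat.of R (R ⧸ P ^ l), extMap X f x = 0) : x = 0 := by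
  -- Noetherian induction on the kernel of a quotient map Y → Z: each round splits a cyclic summand
  -- off Z and passes to the quotient by it.
  suffices H : ∀ (K : Submodule R Y) (Z : ModuleCat.{u} R) (g : Y ⟶ Z),
      Function.Surjective g.hom → LinearMap.ker g.hom = K → ∀ x : Ext X Z 1,
      (∀ l ∈ Set.Icc 1 n, ∀ f : Z ⟶ ModuleCat.of R (R ⧸ P ^ l), extMap X f x = 0) → x = 0 from
    H _ Y (𝟙 Y) Function.surjective_id rfl x hx
  clear hx x
  intro K
  induction K using WellFoundedGT.induction with
  | ind K ih =>
  intro Z g hg hgK x hx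
  by_cases hZ : ∀ z : Z, z = 0
  · have h0 : 𝟙 Z = 0 := by ext z; exact hZ z
    rw [← extMap_id x, h0, extMap_zero]
  push Not at hZ
  have hann : ∀ p ∈ P ^ n, ∀ z : Z, p • z = 0 := by
    intro p hp z
    obtain ⟨y, rfl⟩ := hg z
    rw [← map_smul, hY p hp, map_zero]
  classical
  let H : ∃ l, ∀ p ∈ P ^ l, ∀ z : Z, p • z = 0 := ⟨n, hann⟩
  let l := Nat.find H
  have hl : ∀ p ∈ P ^ l, ∀ z : Z, p • z = 0 := Nat.find_spec H
  have hln : l ≤ n := Nat.find_min' H hann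
  have hl1 : 1 ≤ l := by
    rw [Nat.one_le_iff_ne_zero]
    intro h0
    obtain ⟨z, hz⟩ := hZ
    exact hz (by simpa using hl 1 (by simp [h0]) z)
  have hlt := Nat.find_min H (Nat.sub_one_lt_of_lt hl1)
  push Not at hlt
  obtain ⟨p₀, hp₀, z, hz⟩ := hlt
  have htop : (P ^ l • ⊤ : Submodule R Z) = ⊥ := by
    rw [eq_bot_iff, Submodule.smul_le]
    intro p hp z _
    exact (Submodule.mem_bot R).2 (hl p hp z)
  -- By minimality of l some p₀ in P^(l-1) does not kill z. The annihilator of z is therefore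
  -- exactly P^l, and self-injectivity splits off Rz.
  obtain ⟨f, hf⟩ := exists_linearMap_quotient_pow_eq_one P l z (fun r hr => by
    rw [htop, Submodule.mem_bot] at hr
    obtain ⟨j, hj, hJ⟩ := eq_pow_of_pow_le (P := P) (l := l)
      (J := LinearMap.ker (LinearMap.toSpanSingleton R Z z)) (fun p hp => hl p hp z)
    have hrJ : r ∈ LinearMap.ker (LinearMap.toSpanSingleton R Z z) := hr
    rw [hJ] at hrJ
    rcases hj.eq_or_lt with rfl | hj
    · exact hrJ
    · have : p₀ ∈ P ^ j := Ideal.pow_le_pow_right (by change j ≤ l - 1; omega) hp₀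
      rw [← hJ] at this
      exact absurd this hz)
  let i : (R ⧸ P ^ l) →ₗ[R] Z := Submodule.liftQ _ (LinearMap.toSpanSingleton R Z z)
    (fun p hp => hl p hp z)
  let q : Z ⟶ ModuleCat.of R (Z ⧸ (R ∙ z)) := ModuleCat.ofHom (R ∙ z).mkQ
  let h : ModuleCat.of R (Z ⧸ (R ∙ z)) ⟶ Z := ModuleCat.ofHom
    ((R ∙ z).liftQ (LinearMap.id - i ∘ₗ f) (by
      rw [Submodule.span_singleton_le_iff_mem, LinearMap.mem_ker]
      have : i 1 = z := one_smul R z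
      simp [hf, this]))
  have hsplit : 𝟙 Z = (ModuleCat.ofHom f : Z ⟶ ModuleCat.of R (R ⧸ P ^ l)) ≫ ModuleCat.ofHom i
      + q ≫ h := by
    ext y
    change y = i (f y) + (y - i (f y))
    abel
  have hq : extMap X q x = 0 := by
    refine ih (LinearMap.ker (g ≫ q).hom) ?_ _ (g ≫ q) ?_ rfl _ ?_
    · rw [← hgK]
      obtain ⟨y, hy⟩ := hg z
      refine lt_of_le_of_ne (fun t ht => ?_) fun heq => ?_
      · change q.hom (g.hom t) = 0
        rw [LinearMap.mem_ker.1 ht, map_zero]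
      · have : y ∈ LinearMap.ker (g ≫ q).hom := by
          change q.hom (g.hom y) = 0
          rw [hy]
          exact (Submodule.Quotient.mk_eq_zero _).2 (Submodule.mem_span_singleton_self z)
        rw [← heq, LinearMap.mem_ker, hy] at this
        rw [this, smul_zero] at hz
        exact hz rfl
    · exact (Submodule.mkQ_surjective _).comp hg
    · intro l hl f
      rw [← extMap_comp]
      exact hx l hl _
  rw [← extMap_id x, hsplit, extMap_add, extMap_comp, extMap_comp, hq, hx l ⟨hl1, hln⟩, map_zero,
    map_zero, add_zero]

end Detection

/-! ### Primary decomposition of relative Ext¹, and heredity. -/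

section Structure

open Abelian

variable {R : Type u} [CommRing R] [IsDedekindDomain R]

lemma mem_relExt_adicPoints {A : Set (MaximalSpectrum R)} {X Y : ModuleCat.{u} R} {x : Ext X Y 1} :
    x ∈ relExt (adicPoints A) X Y ↔ ∀ P ∈ A, ∀ f : Y ⟶ adic P, extMap X f x = 0 := by
  constructor
  · exact fun h P hP f => h _ (Or.inr ⟨P, hP, ⟨Iso.refl _⟩⟩) f
  · rintro h N (⟨-, hN⟩ | ⟨P, hP, ⟨e⟩⟩) f
    · exact extMap_eq_zero_of_injective _ _
    · exact extMap_eq_zero_of_iso e (h P hP) f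

lemma mem_relExt_finiteLengthPoints {L : Set (MaximalSpectrum R × ℕ)} {X Y : ModuleCat.{u} R}
    {x : Ext X Y 1} : x ∈ relExt (finiteLengthPoints L) X Y ↔
      ∀ P l, (P, l) ∈ L → ∀ f : Y ⟶ ModuleCat.of R (R ⧸ P.asIdeal ^ l), extMap X f x = 0 := by
  constructor
  · exact fun h P l hL f => h _ ⟨P, l, hL, ⟨Iso.refl _⟩⟩ f
  · rintro h N ⟨P, l, hL, ⟨e⟩⟩ f
    exact extMap_eq_zero_of_iso e (h P l hL) f

lemma extMap_mem_primaryComponent {P : Ideal R} {X Y Z : ModuleCat.{u} R} (f : Y ⟶ Z)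
    {x : Ext X Y 1} (hx : x ∈ P.primaryComponent (Ext X Y 1)) :
    extMap X f x ∈ P.primaryComponent (Ext X Z 1) := by
  obtain ⟨n, hn⟩ := mem_primaryComponent.1 hx
  exact mem_primaryComponent.2 ⟨n, fun p hp => by rw [← map_smul, hn p hp, map_zero]⟩

/-- Primary classes vanish in modules on which an element of a suitable power of the maximal ideal
acts invertibly. -/
lemma extMap_adic_eq_zero_of_ne {P Q : MaximalSpectrum R} (hPQ : P ≠ Q) {X Y : ModuleCat.{u} R}
    {x : Ext X Y 1} (hx : x ∈ P.asIdeal.primaryComponent (Ext X Y 1)) (f : Y ⟶ adic Q) :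
    extMap X f x = 0 := by
  have := P.isMaximal
  have := Q.isMaximal
  obtain ⟨n, hn⟩ := mem_primaryComponent.1 hx
  have hle : ¬ P.asIdeal ^ n ≤ Q.asIdeal := fun h =>
    hPQ (MaximalSpectrum.ext (P.isMaximal.eq_of_le Q.isMaximal.ne_top
      (Q.isMaximal.isPrime.le_of_pow_le h)))
  obtain ⟨a, ha, haQ⟩ := SetLike.not_le_iff_exists.1 hle
  let e : AdicCompletion Q.asIdeal R ≃ₗ[R] AdicCompletion Q.asIdeal R :=
    LinearEquiv.ofBijective (a • LinearMap.id)
      ⟨(injective_iff_map_eq_zero _).2 fun z hz => adicCompletion_smul_injective Q.asIdeal haQ hz,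
        fun z => adicCompletion_smul_surjective Q.asIdeal haQ z⟩
  let i : adic Q ⟶ adic Q := ModuleCat.ofHom e.symm.toLinearMap
  have hi : (a • 𝟙 (adic Q)) ≫ i = 𝟙 (adic Q) := by
    ext z
    exact e.symm_apply_apply z
  have h1 : f = f ≫ (a • 𝟙 (adic Q)) ≫ i := by rw [hi, Category.comp_id]
  rw [h1, extMap_comp, extMap_comp, extMap_smul, extMap_id, ← map_smul, hn a ha, map_zero,
    map_zero]

lemma extMap_quotient_eq_zero_of_ne {P Q : MaximalSpectrum R} (hPQ : P ≠ Q) {l : ℕ}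
    {X Y : ModuleCat.{u} R} {x : Ext X Y 1} (hx : x ∈ P.asIdeal.primaryComponent (Ext X Y 1))
    (f : Y ⟶ ModuleCat.of R (R ⧸ Q.asIdeal ^ l)) : extMap X f x = 0 := by
  have := P.isMaximal
  have := Q.isMaximal
  have h2 : extMap X f x ∈ Q.asIdeal.primaryComponent _ := by
    refine mem_primaryComponent.2 ⟨l, fun p hp => ?_⟩
    rw [← extMap_smul]
    have : p • f = 0 := by
      ext y
      obtain ⟨t, ht⟩ := Ideal.Quotient.mk_surjective (f.hom y)
      change p • f.hom y = 0
      rw [← ht]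
      exact Ideal.Quotient.eq_zero_iff_mem.2 (Ideal.mul_mem_right t _ hp)
    rw [this, extMap_zero]
  exact Submodule.disjoint_def.1
    (disjoint_primaryComponent (fun h => hPQ (MaximalSpectrum.ext h)) _) _
    (extMap_mem_primaryComponent f hx) h2

lemma extMap_smul_quotient_eq_zero {P : MaximalSpectrum R} {l n : ℕ} (hln : l ≤ n)
    {X Y : ModuleCat.{u} R} {x : Ext X Y 1} {p : R} (hp : p ∈ P.asIdeal ^ n)
    (f : Y ⟶ ModuleCat.of R (R ⧸ P.asIdeal ^ l)) : extMap X f (p • x) = 0 := by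
  rw [map_smul, ← extMap_smul]
  have : p • f = 0 := by
    ext y
    obtain ⟨t, ht⟩ := Ideal.Quotient.mk_surjective (f.hom y)
    change p • f.hom y = 0
    rw [← ht]
    exact Ideal.Quotient.eq_zero_iff_mem.2
      (Ideal.mul_mem_right t _ (Ideal.pow_le_pow_right hln hp))
  rw [this, extMap_zero]

/-- A primary class in `Ext¹(X, R)` that vanishes in the completion is zero. -/
lemma eq_zero_of_extMap_adic_eq_zero (P : MaximalSpectrum R) {X Y : ModuleCat.{u} R}
    [Module.Finite R X] {x : Ext X Y 1} (hx : x ∈ P.asIdeal.primaryComponent (Ext X Y 1))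
    (h : ∀ f : Y ⟶ adic P, extMap X f x = 0) (g : Y ⟶ ModuleCat.of R R) : extMap X g x = 0 := by
  have := P.isMaximal
  set z := extMap X g x with hz
  have hzk : ∀ k, z ∈ (P.asIdeal ^ k • ⊤ : Submodule R (Ext X (ModuleCat.of R R) 1)) := by
    intro k
    refine mem_smul_top_of_extMap_mkQ_eq_zero _ _ ?_
    let i : ModuleCat.of R R ⟶ adic P := ModuleCat.ofHom (AdicCompletion.of P.asIdeal R)
    let ev : adic P ⟶ ModuleCat.of R (R ⧸ (P.asIdeal ^ k • ⊤ : Submodule R R)) :=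
      ModuleCat.ofHom (AdicCompletion.eval P.asIdeal R k)
    -- The projection R → R/P^k factors through the completion, so z lies in every P^k Ext¹(X, R). A
    -- suitable s ∉ P kills this submodule for large k, and z is P-primary, so z = 0.
    have h2 : (ModuleCat.ofHom (P.asIdeal ^ k • ⊤ : Submodule R R).mkQ) = i ≫ ev := rfl
    have h3 : extMap X i z = 0 := by rw [hz, ← extMap_comp, h]
    exact (congrArg (fun t => extMap X t z) h2).trans (by rw [extMap_comp, h3, map_zero])
  obtain ⟨r, hr, hrE⟩ := exists_ne_zero_smul_ext_eq_zero X
  obtain ⟨k, -, s, hs, hsk⟩ := exists_mul_eq_mul_of_ne_zero P.asIdeal hr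
  obtain ⟨j, hj⟩ := mem_primaryComponent.1 (extMap_mem_primaryComponent g hx)
  rw [← Submodule.mem_bot R]
  refine mem_of_smul_mem_of_notMem hs (n := j) ?_ fun p hp => (Submodule.mem_bot R).2 (hj p hp)
  have hle : (P.asIdeal ^ k • ⊤ : Submodule R (Ext X (ModuleCat.of R R) 1)) ≤
      LinearMap.ker (LinearMap.lsmul R _ s) := by
    rw [Submodule.smul_le]
    intro p hp w _
    obtain ⟨t, ht⟩ := hsk p hp
    rw [LinearMap.mem_ker, LinearMap.lsmul_apply, ← mul_smul, ht, mul_smul, hrE]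
  exact hle (hzk k)

/-- The torsion part of a finitely generated module splits off; the complementary projection factors
through maps to `R`. -/
lemma exists_torsion_projection (Y : ModuleCat.{u} R) [Module.Finite R Y] :
    ∃ (e : Y ⟶ Y) (m : ℕ) (g : Fin m → (Y ⟶ ModuleCat.of R R))
      (h : Fin m → (ModuleCat.of R R ⟶ Y)),
      (∀ (P : MaximalSpectrum R) (f : Y ⟶ adic P), e ≫ f = 0) ∧ 𝟙 Y = e + ∑ i, g i ≫ h i := by
  let t := Submodule.torsion R Y
  obtain ⟨m, π, hπ⟩ := Module.Finite.exists_fin' R (Y ⧸ t)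
  obtain ⟨σ, hσ⟩ := Module.projective_lifting_property π LinearMap.id hπ
  obtain ⟨s, hs⟩ := Module.projective_lifting_property t.mkQ LinearMap.id (Submodule.mkQ_surjective _)
  -- This projects onto the torsion, which every map to a torsion-free completion kills.
  let e : Y →ₗ[R] Y := LinearMap.id - s ∘ₗ t.mkQ
  refine ⟨ModuleCat.ofHom e, m, fun i => ModuleCat.ofHom (LinearMap.proj i ∘ₗ σ ∘ₗ t.mkQ),
    fun i => ModuleCat.ofHom (s ∘ₗ π ∘ₗ LinearMap.single R (fun _ : Fin m => R) i), ?_, ?_⟩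
  · intro P f
    have := P.isMaximal
    ext y
    have het : e y ∈ t := by
      rw [← Submodule.ker_mkQ t, LinearMap.mem_ker]
      have := LinearMap.congr_fun hs (t.mkQ y)
      simp only [LinearMap.comp_apply, LinearMap.id_apply] at this
      simp only [e, LinearMap.sub_apply, LinearMap.id_apply, LinearMap.comp_apply, map_sub, this,
        sub_self]
    obtain ⟨a, ha⟩ := het
    change f.hom (e y) = 0
    have h1 : (a : R) • f.hom (e y) = 0 := by
      rw [← map_smul]
      exact (congrArg f.hom ha).trans (map_zero _)
    have htf := adicCompletion_isTorsionFree (R := R) P.asIdeal (V := R)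
    exact ((Module.isTorsionFree_iff_smul_eq_zero.1 htf _ _ h1).resolve_left
      (nonZeroDivisors.ne_zero a.2))
  · ext y
    have h1 : ∑ i, LinearMap.single R (fun _ : Fin m => R) i (σ (t.mkQ y) i) = σ (t.mkQ y) :=
      LinearMap.sum_single_apply _ _
    have h2 : π (σ (t.mkQ y)) = t.mkQ y := LinearMap.congr_fun hσ _
    simp only [ModuleCat.hom_id, ModuleCat.hom_add, ModuleCat.hom_sum, LinearMap.add_apply,
      LinearMap.sum_apply, ModuleCat.hom_comp, ModuleCat.hom_ofHom, LinearMap.comp_apply,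
      LinearMap.proj_apply, LinearMap.id_apply, e, LinearMap.sub_apply]
    rw [← map_sum, ← map_sum, h1, h2, sub_add_cancel]

/-- The `P`-primary part of `Ext¹_{ℰ'_A}(-, Y)` is a natural retract of that of `Ext¹(-, Y)`. -/
lemma exists_primary_retraction (A : Set (MaximalSpectrum R)) (P : MaximalSpectrum R)
    (Y : ModuleCat.{u} R) [Module.Finite R Y] :
    ∃ e : Y ⟶ Y, ∀ (X : ModuleCat.{u} R) [Module.Finite R X],
      (∀ z ∈ P.asIdeal.primaryComponent (Ext X Y 1), extMap X e z ∈ relExt (adicPoints A) X Y) ∧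
      ∀ z ∈ relExt (adicPoints A) X Y ⊓ P.asIdeal.primaryComponent (Ext X Y 1),
        extMap X e z = z := by
  -- For P ∈ A take the torsion projection: on relative classes the complementary part factors
  -- through R and vanishes. For P ∉ A the identity works, since Q-adic completions with Q ≠ P kill
  -- the P-part.
  by_cases hP : P ∈ A
  · obtain ⟨e, m, g, h, he, hid⟩ := exists_torsion_projection Y
    refine ⟨e, fun X _ => ⟨fun z _ => ?_, fun z hz => ?_⟩⟩
    · rw [mem_relExt_adicPoints]
      intro Q _ f
      rw [← extMap_comp, he, extMap_zero]
    · have hg : ∀ i, extMap X (g i) z = 0 := fun i =>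
        eq_zero_of_extMap_adic_eq_zero P hz.2 (mem_relExt_adicPoints.1 hz.1 P hP) (g i)
      conv_rhs => rw [← extMap_id z, hid, extMap_add, extMap_sum]
      simp [extMap_comp, hg]
  · refine ⟨𝟙 Y, fun X _ => ⟨fun z hz => ?_, fun z _ => extMap_id z⟩⟩
    rw [extMap_id, mem_relExt_adicPoints]
    intro Q hQ f
    exact extMap_adic_eq_zero_of_ne (fun h : P = Q => hP (h ▸ hQ)) hz f

/-- The scalar projection followed by the retraction is a linear map from Ext¹ into N_P that fixes
N_P, so it carries P^n Ext¹ into P^n N_P. -/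
lemma mem_pow_smul_relExt_inf_primaryComponent (A : Set (MaximalSpectrum R))
    (P : MaximalSpectrum R) (n : ℕ) {X Y : ModuleCat.{u} R} [Module.Finite R X]
    [Module.Finite R Y] {x : Ext X Y 1}
    (hx : x ∈ relExt (adicPoints A) X Y ⊓ P.asIdeal.primaryComponent (Ext X Y 1))
    (hxn : x ∈ (P.asIdeal ^ n • ⊤ : Submodule R (Ext X Y 1))) :
    x ∈ P.asIdeal ^ n • (relExt (adicPoints A) X Y ⊓ P.asIdeal.primaryComponent (Ext X Y 1)) := by
  have := P.isMaximal
  obtain ⟨e, he⟩ := exists_primary_retraction A P Y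
  obtain ⟨he₁, he₂⟩ := he X
  obtain ⟨r, hr, hrE⟩ := exists_ne_zero_smul_ext_eq_zero X
  obtain ⟨c, -, hc⟩ := exists_smul_eq_primary_projection P.asIdeal hr
  obtain ⟨hc₁, hc₂⟩ := hc (hrE Y)
  let φ : Ext X Y 1 →ₗ[R] Ext X Y 1 := extMap X e ∘ₗ LinearMap.lsmul R _ c
  have hφx : φ x = x := by
    change extMap X e (c • x) = x
    rw [hc₂ x hx.2, he₂ x hx]
  have hφ : (⊤ : Submodule R (Ext X Y 1)).map φ ≤
      relExt (adicPoints A) X Y ⊓ P.asIdeal.primaryComponent (Ext X Y 1) := by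
    rintro _ ⟨z, -, rfl⟩
    exact ⟨he₁ _ (hc₁ z), extMap_mem_primaryComponent e (hc₁ z)⟩
  have h1 := Submodule.mem_map_of_mem (f := φ) hxn
  rw [hφx, Submodule.map_smul''] at h1
  exact Submodule.smul_mono le_rfl hφ h1

lemma exists_extComap_eq_of_mem_relExt_inf (A : Set (MaximalSpectrum R))
    (P : MaximalSpectrum R) {W X Y : ModuleCat.{u} R} [Module.Finite R W] [Module.Finite R X]
    [Module.Finite R Y] (j : W ⟶ X) (hj : Function.Injective j.hom) :
    relExt (adicPoints A) W Y ⊓ P.asIdeal.primaryComponent (Ext W Y 1) ≤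
      (relExt (adicPoints A) X Y ⊓ P.asIdeal.primaryComponent (Ext X Y 1)).map (extComap j Y) := by
  intro x hx
  have := P.isMaximal
  obtain ⟨e, he⟩ := exists_primary_retraction A P Y
  obtain ⟨r, hr, hrE⟩ := exists_ne_zero_smul_ext_eq_zero X
  obtain ⟨r', hr', hrE'⟩ := exists_ne_zero_smul_ext_eq_zero W
  -- The product r r' kills both Ext¹ modules, so one scalar c projects on both and commutes with
  -- restriction.
  obtain ⟨c, -, hc⟩ := exists_smul_eq_primary_projection P.asIdeal (mul_ne_zero hr hr')
  obtain ⟨hc₁, -⟩ := hc (V := Ext X Y 1) (fun z => by rw [mul_comm, mul_smul, hrE, smul_zero])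
  obtain ⟨-, hc₂⟩ := hc (V := Ext W Y 1) (fun z => by rw [mul_smul, hrE', smul_zero])
  obtain ⟨z, rfl⟩ := extComap_surjective j hj Y x
  refine ⟨extMap X e (c • z), ⟨(he X).1 _ (hc₁ z), extMap_mem_primaryComponent e (hc₁ z)⟩, ?_⟩
  rw [extComap_extMap, map_smul, hc₂ _ hx.2, (he W).2 _ hx]

variable (M : Set (MaximalSpectrum R)) (n : MaximalSpectrum R → ℕ) (A : Set (MaximalSpectrum R))

/-- `ℱ_L` together with the indecomposable injectives and the `P`-adic completions, `P ∈ A`. -/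
abbrev standardPoints : ObjectProperty (ModuleCat.{u} R) :=
  finiteLengthPoints (initialSegments M n) ⊔ adicPoints A

lemma mem_initialSegments {P : MaximalSpectrum R} {l : ℕ} :
    (P, l) ∈ initialSegments M n ↔ P ∈ M ∧ 1 ≤ l ∧ l ≤ n P := by
  simp only [initialSegments, Set.mem_iUnion, Set.mem_prod, Set.mem_singleton_iff, Set.mem_Icc]
  constructor
  · rintro ⟨Q, hQ, rfl, h⟩
    exact ⟨hQ, h⟩
  · rintro ⟨hP, h⟩
    exact ⟨P, hP, rfl, h⟩

variable {X Y : ModuleCat.{u} R}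

lemma mem_pow_smul_of_mem_relExt_standardPoints [Module.Finite R X] [Module.Finite R Y]
    {P : MaximalSpectrum R} (hP : P ∈ M) {x : Ext X Y 1}
    (hx : x ∈ relExt (standardPoints M n A) X Y)
    (hxP : x ∈ P.asIdeal.primaryComponent (Ext X Y 1)) :
    x ∈ P.asIdeal ^ n P •
      (relExt (adicPoints A) X Y ⊓ P.asIdeal.primaryComponent (Ext X Y 1)) := by
  have := P.isMaximal
  rw [relExt_sup, Submodule.mem_inf] at hx
  refine mem_pow_smul_relExt_inf_primaryComponent A P (n P) ⟨hx.2, hxP⟩ ?_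
  refine mem_smul_top_of_extMap_mkQ_eq_zero _ _ ?_
  have : Module.Finite R (ModuleCat.of R (Y ⧸ (P.asIdeal ^ n P • ⊤ : Submodule R Y))) :=
    inferInstanceAs (Module.Finite R (Y ⧸ (P.asIdeal ^ n P • ⊤ : Submodule R Y)))
  refine eq_zero_of_extMap_quotient_pow_eq_zero P.asIdeal (n P)
    (ModuleCat.of R (Y ⧸ (P.asIdeal ^ n P • ⊤ : Submodule R Y))) ?_ _ ?_
  · intro p hp y
    obtain ⟨y, rfl⟩ := Submodule.mkQ_surjective _ y
    exact (Submodule.Quotient.mk_eq_zero _).2 (Submodule.smul_mem_smul hp Submodule.mem_top)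
  · intro l hl f
    rw [← extMap_comp]
    exact mem_relExt_finiteLengthPoints.1 hx.1 P l
      ((mem_initialSegments M n).2 ⟨hP, hl.1, hl.2⟩) _

lemma pow_smul_le_relExt_standardPoints (P : MaximalSpectrum R) :
    P.asIdeal ^ n P • (relExt (adicPoints A) X Y ⊓ P.asIdeal.primaryComponent (Ext X Y 1)) ≤
      relExt (standardPoints M n A) X Y := by
  rw [Submodule.smul_le]
  rintro p hp x ⟨hx, hxP⟩
  rw [relExt_sup]
  refine ⟨mem_relExt_finiteLengthPoints.2 fun Q l hQ f => ?_, Submodule.smul_mem _ _ hx⟩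
  by_cases h : P = Q
  · subst h
    exact extMap_smul_quotient_eq_zero ((mem_initialSegments M n).1 hQ).2.2 hp f
  · rw [map_smul, extMap_quotient_eq_zero_of_ne h hxP f, smul_zero]

lemma inf_iSup_le_relExt_standardPoints :
    relExt (adicPoints A) X Y ⊓ (⨆ Q ∈ Mᶜ, Q.asIdeal.primaryComponent (Ext X Y 1)) ≤
      relExt (standardPoints M n A) X Y := by
  rintro x ⟨hx, hxP⟩
  rw [relExt_sup]
  refine ⟨mem_relExt_finiteLengthPoints.2 fun P l hP f => ?_, hx⟩
  have hle : (⨆ Q ∈ Mᶜ, Q.asIdeal.primaryComponent (Ext X Y 1)) ≤ LinearMap.ker (extMap X f) :=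
    iSup₂_le fun Q hQ z hz => extMap_quotient_eq_zero_of_ne
      (fun h : Q = P => hQ (h ▸ ((mem_initialSegments M n).1 hP).1)) hz f
  exact hle hxP

lemma radSummand_le_relExt (k : Option M) :
    radSummand M n (relExt (adicPoints A) X Y) k ≤ relExt (standardPoints M n A) X Y := by
  cases k with
  | none => exact inf_iSup_le_relExt_standardPoints M n A
  | some P => exact pow_smul_le_relExt_standardPoints M n A P.1

/-- Membership is local: at each P a scalar c ∉ P moves x into the P-part, where a single summand is
responsible. -/
theorem relExt_standardPoints_eq_iSup [Module.Finite R X] [Module.Finite R Y] :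
    relExt (standardPoints M n A) X Y = ⨆ k, radSummand M n (relExt (adicPoints A) X Y) k := by
  refine le_antisymm (fun x hx => ?_) (iSup_le (radSummand_le_relExt M n A))
  obtain ⟨r, hr, hrE⟩ := exists_ne_zero_smul_ext_eq_zero X
  refine mem_of_forall_exists_smul_mem fun P => ?_
  have := P.isMaximal
  obtain ⟨c, hc, hcE⟩ := exists_smul_eq_primary_projection P.asIdeal hr
  have hcP := (hcE (hrE Y)).1 x
  have hcx := Submodule.smul_mem _ c hx
  refine ⟨c, fun h => P.isMaximal.ne_top ((Ideal.eq_top_iff_one _).2 (by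
    simpa using add_mem hc h)), ?_⟩
  by_cases hP : P ∈ M
  · exact Submodule.mem_iSup_of_mem (some ⟨P, hP⟩)
      (mem_pow_smul_of_mem_relExt_standardPoints M n A hP hcx hcP)
  · rw [relExt_sup] at hcx
    refine Submodule.mem_iSup_of_mem none ⟨hcx.2, ?_⟩
    exact Submodule.mem_iSup_of_mem P (Submodule.mem_iSup_of_mem hP hcP)

lemma iSupIndep_radSummand [Module.Finite R X] (N : Submodule R (Ext X Y 1)) :
    iSupIndep (radSummand M n N) := by
  obtain ⟨r, hr, hrE⟩ := exists_ne_zero_smul_ext_eq_zero X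
  have hsome : ∀ P : M, radSummand M n N (some P) ≤
      P.1.asIdeal.primaryComponent (Ext X Y 1) :=
    fun P => Submodule.smul_le_right.trans inf_le_right
  have hc : ∀ P : MaximalSpectrum R, ∃ c : R, c ∉ P.asIdeal ∧
      ∀ Q : MaximalSpectrum R, Q ≠ P →
        Q.asIdeal.primaryComponent (Ext X Y 1) ≤ LinearMap.ker (LinearMap.lsmul R _ c) := by
    intro P
    have := P.isMaximal
    obtain ⟨c, hc, hcE⟩ := exists_smul_eq_primary_projection P.asIdeal hr
    refine ⟨c, fun h => P.isMaximal.ne_top ((Ideal.eq_top_iff_one _).2 (by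
      simpa using add_mem hc h)), fun Q hQ z hz => ?_⟩
    have := Q.isMaximal
    exact Submodule.disjoint_def.1
      (disjoint_primaryComponent (fun h => hQ (MaximalSpectrum.ext h)) _) _
      (Submodule.smul_mem _ c hz) ((hcE (hrE Y)).1 z)
  intro k
  rw [Submodule.disjoint_def]
  intro x hx hx'
  rw [← Submodule.mem_bot R]
  refine mem_of_forall_exists_smul_mem fun P => ?_
  obtain ⟨c, hcP, hcQ⟩ := hc P
  refine ⟨c, hcP, (Submodule.mem_bot R).2 ?_⟩
  -- The scalar c kills every summand except the one responsible for P. Either k or all other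
  -- indices avoid that exception, so c kills x.
  have hker : ∀ k', (∀ h : P ∈ M, k' ≠ some ⟨P, h⟩) → (k' = none → P ∈ M) →
      radSummand M n N k' ≤ LinearMap.ker (LinearMap.lsmul R _ c) := by
    intro k' h₁ h₂
    cases k' with
    | none => exact inf_le_right.trans (iSup₂_le fun Q hQ => hcQ Q fun h => hQ (h ▸ h₂ rfl))
    | some Q =>
      refine (hsome Q).trans (hcQ Q.1 ?_)
      rintro rfl
      exact h₁ Q.2 rfl
  by_cases hk : (∀ h : P ∈ M, k ≠ some ⟨P, h⟩) ∧ (k = none → P ∈ M)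
  · exact hker k hk.1 hk.2 hx
  · refine (iSup₂_le fun k' hk' => hker k' ?_ ?_ :
      (⨆ (k') (_ : k' ≠ k), radSummand M n N k') ≤ LinearMap.ker (LinearMap.lsmul R _ c)) hx'
    · rintro h rfl
      apply hk
      exact ⟨fun _ => hk'.symm, fun _ => h⟩
    · rintro rfl
      by_contra hP
      exact hk ⟨fun h => absurd h hP, fun h => absurd h.symm hk'⟩

/-- Lift each P-part separately: restriction is onto on the P-parts for ℰ'_A and commutes with
multiplication by P^n. -/
theorem exists_extComap_eq_of_mem_relExt_standardPoints {W X Y : ModuleCat.{u} R}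
    [Module.Finite R W] [Module.Finite R X] [Module.Finite R Y] (j : W ⟶ X)
    (hj : Function.Injective j.hom) :
    relExt (standardPoints M n A) W Y ≤
      (relExt (standardPoints M n A) X Y).map (extComap j Y) := by
  intro x hx
  obtain ⟨r, hr, hrE⟩ := exists_ne_zero_smul_ext_eq_zero W
  refine mem_of_forall_exists_smul_mem fun P => ?_
  have := P.isMaximal
  obtain ⟨c, hc, hcE⟩ := exists_smul_eq_primary_projection P.asIdeal hr
  have hcP := (hcE (hrE Y)).1 x
  have hcx := Submodule.smul_mem _ c hx
  refine ⟨c, fun h => P.isMaximal.ne_top ((Ideal.eq_top_iff_one _).2 (by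
    simpa using add_mem hc h)), ?_⟩
  have hle := exists_extComap_eq_of_mem_relExt_inf A P (Y := Y) j hj
  by_cases hP : P ∈ M
  · have h1 := Submodule.smul_mono (le_refl (P.asIdeal ^ n P)) hle
      (mem_pow_smul_of_mem_relExt_standardPoints M n A hP hcx hcP)
    rw [← Submodule.map_smul''] at h1
    exact Submodule.map_mono (pow_smul_le_relExt_standardPoints M n A P) h1
  · rw [relExt_sup] at hcx
    refine Submodule.map_mono ?_ (hle ⟨hcx.2, hcP⟩)
    refine le_trans ?_ (inf_iSup_le_relExt_standardPoints M n A)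
    exact inf_le_inf_left _ (le_iSup₂_of_le P hP le_rfl)

theorem isHereditaryExact_standardPoints :
    IsHereditaryExact (exactStructure (standardPoints M n A)) := by
  refine isHereditaryExact_of_extOne_surjective fun W X Y j hj z hz => ?_
  have hj' : Function.Injective j.hom.hom := (ModuleCat.mono_iff_injective _).1
    (inferInstanceAs (Mono ((forget₂ (FGModuleCat.{u} R) (ModuleCat.{u} R)).map j)))
  have : Module.Finite R W.obj := W.property
  have : Module.Finite R X.obj := X.property
  have : Module.Finite R Y.obj := Y.property
  rw [extOne_eq_relExt] at hz
  obtain ⟨z', hz', h⟩ :=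
    exists_extComap_eq_of_mem_relExt_standardPoints M n A (Y := Y.obj) j.hom hj' hz
  exact ⟨z', by rw [extOne_eq_relExt]; exact hz', h⟩

theorem isDirectSum_standardPoints (X Y : FGModuleCat.{u} R) :
    IsDirectSum (extOne (exactStructure (standardPoints M n A)) X Y)
      (radSummand M n (relExt (adicPoints A) X.obj Y.obj)) := by
  have : Module.Finite R X.obj := X.property
  have : Module.Finite R Y.obj := Y.property
  exact ⟨iSupIndep_radSummand M n _, by
    rw [extOne_eq_relExt, relExt_standardPoints_eq_iSup]⟩

end Structure

/-! ### Divisible submodules are injective, hence direct summands. -/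

section Divisible

variable {R : Type u} [CommRing R]

/-- Every nonzero scalar acts surjectively on the submodule `D`. -/
def IsDivisibleSubmodule {V : Type v} [AddCommGroup V] [Module R V] (D : Submodule R V) : Prop :=
  ∀ r : R, r ≠ 0 → ∀ x ∈ D, ∃ y ∈ D, r • y = x

/-- An indecomposable module is isomorphic to each of its nonzero retracts. -/
lemma nonempty_iso_of_indecomposable {N A : ModuleCat.{u} R} (hN : Indecomposable N)
    (i : A ⟶ N) (p : N ⟶ A) (hip : i ≫ p = 𝟙 A) (hA : ¬ IsZero A) : Nonempty (N ≅ A) := by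
  let S : ShortComplex (ModuleCat.{u} R) := ShortComplex.mk (kernel.ι p) p (kernel.condition p)
  have hS : S.Exact := ShortComplex.exact_of_f_is_kernel S (kernelIsKernel p)
  have hm : Mono S.f := inferInstanceAs (Mono (kernel.ι p))
  let e := (ShortComplex.Splitting.ofExactOfSection S hS i hip hm).isoBinaryBiproduct
  have h0 : IsZero (kernel p) := (hN.2 _ _ e).resolve_right hA
  have hmono : Mono p := Preadditive.mono_of_kernel_zero (h0.eq_of_src _ _)
  refine ⟨⟨p, i, ?_, hip⟩⟩
  rw [← cancel_mono p, Category.assoc, hip, Category.comp_id, Category.id_comp]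

variable [IsDedekindDomain R]

lemma baer_of_isDivisibleSubmodule {V : Type v} [AddCommGroup V] [Module R V] {D : Submodule R V}
    (hD : IsDivisibleSubmodule D) : Module.Baer R D := by
  intro I g
  by_cases hI : I = ⊥
  · subst hI
    refine ⟨0, fun x hx => ?_⟩
    have h0 : (⟨x, hx⟩ : (⊥ : Ideal R)) = 0 := Subtype.ext ((Submodule.mem_bot R).1 hx)
    rw [h0, map_zero, LinearMap.zero_apply]
  obtain ⟨r, hrI, hr⟩ := Submodule.exists_mem_ne_zero_of_ne_bot hI
  obtain ⟨J, hJ⟩ := Ideal.dvd_iff_le.2 ((Ideal.span_singleton_le_iff_mem I).2 hrI)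
  have hdiv : ∀ x ∈ I, ∀ c ∈ J, ∃ t, x * c = r * t := by
    intro x hx c hc
    have : x * c ∈ Ideal.span {r} := by rw [hJ]; exact Ideal.mul_mem_mul hx hc
    obtain ⟨t, ht⟩ := Ideal.mem_span_singleton'.1 this
    exact ⟨t, by rw [← ht, mul_comm]⟩
  -- Here IJ = rR, and d satisfies g(xz/r) = x d for all x in I. For z = ac with a ∈ I and c ∈ J,
  -- divide g(a) by r and multiply by c; such d add up. The case z = r says that g is x ↦ x d.
  have key : ∀ z ∈ I * J, (∀ x ∈ I, ∃ u ∈ I, r * u = x * z) ∧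
      ∃ d : D, ∀ x ∈ I, ∀ u (hu : u ∈ I), r * u = x * z → g ⟨u, hu⟩ = x • d := by
    intro z hz
    refine Submodule.mul_induction_on hz (fun a ha c hc => ?_) ?_
    · obtain ⟨d, hdD, hd⟩ := hD r hr (g ⟨a, ha⟩) (g ⟨a, ha⟩).2
      refine ⟨fun x hx => ?_, c • ⟨d, hdD⟩, fun x hx u hu h => ?_⟩
      · obtain ⟨t, ht⟩ := hdiv x hx c hc
        exact ⟨a * t, I.mul_mem_right t ha, by linear_combination (-a) * ht⟩
      · obtain ⟨t, ht⟩ := hdiv x hx c hc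
        have hu' : u = t * a := mul_left_cancel₀ hr (by linear_combination h + a * ht)
        have hu'' : (⟨u, hu⟩ : I) = t • ⟨a, ha⟩ := Subtype.ext hu'
        have hd' : g ⟨a, ha⟩ = r • (⟨d, hdD⟩ : D) := Subtype.ext hd.symm
        rw [hu'', map_smul, hd', ← mul_smul, ← mul_smul, ht, mul_comm]
    · rintro z₁ z₂ ⟨h₁, d₁, hd₁⟩ ⟨h₂, d₂, hd₂⟩
      refine ⟨fun x hx => ?_, d₁ + d₂, fun x hx u hu h => ?_⟩
      · obtain ⟨u₁, hu₁, h₁⟩ := h₁ x hx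
        obtain ⟨u₂, hu₂, h₂⟩ := h₂ x hx
        exact ⟨u₁ + u₂, add_mem hu₁ hu₂, by rw [mul_add, h₁, h₂, mul_add]⟩
      · obtain ⟨u₁, hu₁, h₁⟩ := h₁ x hx
        obtain ⟨u₂, hu₂, h₂⟩ := h₂ x hx
        have hu' : u = u₁ + u₂ := mul_left_cancel₀ hr (by linear_combination h - h₁ - h₂)
        have hu'' : (⟨u, hu⟩ : I) = ⟨u₁, hu₁⟩ + ⟨u₂, hu₂⟩ := Subtype.ext hu'
        rw [hu'', map_add, hd₁ x hx u₁ hu₁ h₁, hd₂ x hx u₂ hu₂ h₂, smul_add]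
  obtain ⟨-, d, hd⟩ := key r (hJ ▸ Ideal.mem_span_singleton_self r)
  exact ⟨LinearMap.toSpanSingleton R D d, fun x hx => (hd x hx x hx (mul_comm _ _)).symm⟩

lemma injective_of_isDivisibleSubmodule {N : ModuleCat.{u} R} (hN : Indecomposable N)
    {D : Submodule R N} (hD : IsDivisibleSubmodule D) (hD0 : D ≠ ⊥) : Injective N := by
  have hbaer := baer_of_isDivisibleSubmodule hD
  have := hbaer.injective
  have hinj : Injective (ModuleCat.of R D) := Module.injective_object_of_injective_module R D
  obtain ⟨p, hp⟩ := hbaer.extension_property D.subtype D.injective_subtype LinearMap.id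
  obtain ⟨e⟩ := nonempty_iso_of_indecomposable hN (A := ModuleCat.of R D) (ModuleCat.ofHom D.subtype)
    (ModuleCat.ofHom p) (by rw [← ModuleCat.ofHom_comp, hp]; rfl) (fun h => hD0 (by
      have := ModuleCat.subsingleton_of_isZero h
      exact (Submodule.subsingleton_iff_eq_bot).1 this))
  exact Injective.of_iso e.symm hinj

end Divisible

/-! ### Torsion yields a divisible submodule or a summand R/P^l. -/

section TorsionCase

variable {R : Type u} [CommRing R] [IsDedekindDomain R] {V : Type v} [AddCommGroup V] [Module R V]

/-- An element of order `P` and finite height gives a direct summand `R ⧸ P ^ (k + 1)`. -/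
lemma exists_retract_quotient_pow (P : Ideal R) [P.IsMaximal] {x : V} (hx : ∀ p ∈ P, p • x = 0)
    {k : ℕ} (hxk : x ∈ (P ^ k • ⊤ : Submodule R V)) (hxk' : x ∉ (P ^ (k + 1) • ⊤ : Submodule R V)) :
    ∃ (i : (R ⧸ P ^ (k + 1)) →ₗ[R] V) (f : V →ₗ[R] R ⧸ P ^ (k + 1)), f ∘ₗ i = LinearMap.id := by
  have hle : ¬ P ^ k ≤ P ^ (k + 1) := fun h => hxk' (Submodule.smul_mono_left h hxk)
  obtain ⟨a, ha, ha'⟩ := SetLike.not_le_iff_exists.1 hle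
  obtain ⟨s, hs, h⟩ := exists_mul_eq_mul_of_mem_pow P ha'
  obtain ⟨y₀, -, hy₀⟩ := exists_smul_eq_smul_of_mem_smul h hxk
  have hP : ∀ q ∈ P ^ (k + 1), ∃ p ∈ P, s * q = a * p := by
    intro q hq
    rw [pow_succ] at hq
    refine Submodule.mul_induction_on hq (fun b hb p hp => ?_) ?_
    · obtain ⟨t, ht⟩ := h b hb
      exact ⟨t * p, P.mul_mem_left t hp, by linear_combination p * ht⟩
    · rintro q₁ q₂ ⟨p₁, hp₁, h₁⟩ ⟨p₂, hp₂, h₂⟩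
      exact ⟨p₁ + p₂, add_mem hp₁ hp₂, by rw [mul_add, h₁, h₂, mul_add]⟩
  have hy : ∀ q ∈ P ^ (k + 1), q • s • y₀ = 0 := by
    intro q hq
    obtain ⟨p, hp, hqp⟩ := hP q hq
    rw [← mul_smul, mul_comm, hqp, mul_comm, mul_smul, ← hy₀, smul_comm, hx p hp, smul_zero]
  -- If the annihilator of s y₀ modulo P^(k+1) V were P^j with j ≤ k, it would contain a, and a s y₀
  -- = s s x would have height above k. Cancelling s twice contradicts the choice of x.
  obtain ⟨f, hf⟩ := exists_linearMap_quotient_pow_eq_one P (k + 1) (s • y₀) (fun r hr => by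
    obtain ⟨j, hj, hJ⟩ := eq_pow_of_pow_le (P := P) (l := k + 1)
      (J := (P ^ (k + 1) • ⊤ : Submodule R V).comap (LinearMap.toSpanSingleton R V (s • y₀)))
      (fun q hq => by
        rw [Submodule.mem_comap, LinearMap.toSpanSingleton_apply, hy q hq]; exact zero_mem _)
    have hrJ : r ∈ (P ^ (k + 1) • ⊤ : Submodule R V).comap
      (LinearMap.toSpanSingleton R V (s • y₀)) := hr
    rw [hJ] at hrJ
    rcases hj.eq_or_lt with rfl | hj
    · exact hrJ
    · have h1 : a ∈ P ^ j := Ideal.pow_le_pow_right (by omega) ha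
      rw [← hJ, Submodule.mem_comap, LinearMap.toSpanSingleton_apply, smul_comm, ← hy₀] at h1
      refine absurd ?_ hxk'
      have hPx : ∀ z : V, (∀ p ∈ P, p • z = 0) → ∀ p ∈ P ^ 1,
          p • z ∈ (P ^ (k + 1) • ⊤ : Submodule R V) := by
        intro z hz p hp
        rw [hz p (by simpa using hp)]
        exact zero_mem _
      refine mem_of_smul_mem_of_notMem hs (mem_of_smul_mem_of_notMem hs h1 (hPx _ ?_)) (hPx _ hx)
      intro p hp
      rw [smul_comm, hx p hp, smul_zero])
  refine ⟨Submodule.liftQ _ (LinearMap.toSpanSingleton R V (s • y₀)) (fun q hq => hy q hq), f, ?_⟩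
  refine Submodule.linearMap_qext _ (LinearMap.ext_ring ?_)
  change f ((1 : R) • s • y₀) = 1
  rw [one_smul, hf]

/-- If the elements of order `P` have infinite height, the `P`-primary component is divisible. -/
lemma isDivisibleSubmodule_primaryComponent (P : Ideal R) [P.IsMaximal]
    (hP : P ≠ ⊥) (h : ∀ x : V, (∀ p ∈ P, p • x = 0) → ∀ k, x ∈ (P ^ k • ⊤ : Submodule R V)) :
    IsDivisibleSubmodule (P.primaryComponent V) := by
  have key : ∀ (m : ℕ) (x : V), (∀ p ∈ P ^ m, p • x = 0) → ∀ k,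
      x ∈ (P ^ k • ⊤ : Submodule R V) := by
    intro m
    induction m with
    | zero =>
      intro x hx k
      have : x = 0 := by simpa using hx 1 (by simp)
      rw [this]
      exact zero_mem _
    | succ m ih =>
      intro x hx k
      obtain ⟨a, ha, ha'⟩ := SetLike.exists_of_lt
        (Ideal.pow_succ_lt_pow hP m)
      obtain ⟨s, hs, hsa⟩ := exists_mul_eq_mul_of_mem_pow P ha'
      -- The element a x is killed by P, so it has height m + k and s a x = a w with w in P^k V.
      -- Then P^m kills s (s x - w), and the induction hypothesis applies.
      have hax := h (a • x) (fun p hp => by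
        rw [← mul_smul]
        exact hx _ (by rw [pow_succ, mul_comm p]; exact Ideal.mul_mem_mul ha hp)) (m + k)
      rw [pow_add, mul_smul] at hax
      obtain ⟨w, hw, hw'⟩ := exists_smul_eq_smul_of_mem_smul hsa hax
      have h1 := ih (s • (s • x - w)) (fun p hp => by
        obtain ⟨t, ht⟩ := hsa p hp
        rw [← mul_smul, mul_comm, ht, mul_comm, mul_smul, smul_sub, ← hw', smul_comm a s, sub_self,
          smul_zero]) k
      have h2 : s • s • x ∈ (P ^ k • ⊤ : Submodule R V) := by
        have := add_mem h1 (Submodule.smul_mem _ s hw)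
        rwa [smul_sub, sub_add_cancel] at this
      have h3 : ∀ y : V, (∀ p ∈ P ^ (m + 1), p • y = 0) → ∀ p ∈ P ^ (m + 1),
          p • y ∈ (P ^ k • ⊤ : Submodule R V) := by
        intro y hy p hp
        rw [hy p hp]
        exact zero_mem _
      refine mem_of_smul_mem_of_notMem hs (mem_of_smul_mem_of_notMem hs h2 (h3 _ ?_)) (h3 _ hx)
      intro p hp
      rw [smul_comm, hx p hp, smul_zero]
  intro r hr x hx
  obtain ⟨m, hm⟩ := mem_primaryComponent.1 hx
  obtain ⟨k, -, s, hs, hsr⟩ := exists_mul_eq_mul_of_ne_zero P hr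
  obtain ⟨w, -, hw⟩ := exists_smul_eq_smul_of_mem_smul hsr (key m x hm k)
  -- While s x = r w, the quotient w itself need not be P-primary; s w is, since s P^k ⊆ rR.
  have hsw : s • w ∈ P.primaryComponent V := by
    refine mem_primaryComponent.2 ⟨m + k, fun q hq => ?_⟩
    rw [pow_add] at hq
    refine Submodule.mul_induction_on hq (fun b hb c hc => ?_) fun b c hb hc => by
      rw [add_smul, hb, hc, add_zero]
    obtain ⟨t, ht⟩ := hsr c hc
    rw [← mul_smul, show b * c * s = b * (s * c) by ring, ht,
      show b * (r * t) = t * b * r by ring, mul_smul, ← hw, mul_smul, smul_comm b, hm b hb,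
      smul_zero, smul_zero]
  have hmem : x ∈ (P.primaryComponent V).map (LinearMap.lsmul R V r) := by
    refine mem_of_smul_mem_of_notMem (n := m) hs (mem_of_smul_mem_of_notMem (n := m) hs ?_ ?_) ?_
    · exact ⟨s • w, hsw, by rw [LinearMap.lsmul_apply, smul_comm, ← hw]⟩
    · intro p hp
      rw [smul_comm, hm p hp, smul_zero]
      exact zero_mem _
    · intro p hp
      rw [hm p hp]
      exact zero_mem _
  obtain ⟨y, hy, hyx⟩ := hmem
  exact ⟨y, hy, hyx⟩

/-- A module with torsion has a nonzero divisible submodule or a cyclic direct summand of finite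
length. -/
lemma exists_divisible_or_exists_retract (hR : ∀ P : MaximalSpectrum R, P.asIdeal ≠ ⊥)
    (hV : ¬ Module.IsTorsionFree R V) :
    (∃ D : Submodule R V, IsDivisibleSubmodule D ∧ D ≠ ⊥) ∨
    ∃ (P : MaximalSpectrum R) (l : ℕ) (i : (R ⧸ P.asIdeal ^ (l + 1)) →ₗ[R] V)
      (f : V →ₗ[R] R ⧸ P.asIdeal ^ (l + 1)), f ∘ₗ i = LinearMap.id := by
  rw [Module.isTorsionFree_iff_smul_eq_zero] at hV
  push Not at hV
  obtain ⟨r, x, hrx, hr, hx⟩ := hV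
  have hP : ∃ P : MaximalSpectrum R, P.asIdeal.primaryComponent V ≠ ⊥ := by
    by_contra! hbot
    refine hx ((Submodule.mem_bot R).1 (mem_of_forall_exists_smul_mem fun P => ?_))
    have := P.isMaximal
    obtain ⟨k, -, s, hs, h⟩ := exists_mul_eq_mul_of_ne_zero P.asIdeal hr
    refine ⟨s, hs, ?_⟩
    rw [← hbot P]
    refine mem_primaryComponent.2 ⟨k, fun p hp => ?_⟩
    obtain ⟨t, ht⟩ := h p hp
    rw [← mul_smul, mul_comm, ht, mul_comm, mul_smul, hrx, smul_zero]
  obtain ⟨P, hP⟩ := hP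
  have := P.isMaximal
  by_cases hh : ∀ x : V, (∀ p ∈ P.asIdeal, p • x = 0) → ∀ k,
      x ∈ (P.asIdeal ^ k • ⊤ : Submodule R V)
  · exact Or.inl ⟨_, isDivisibleSubmodule_primaryComponent P.asIdeal (hR P) hh, hP⟩
  · push Not at hh
    obtain ⟨x, hx, hk⟩ := hh
    classical
    have hpos : Nat.find hk ≠ 0 := by
      intro h0
      have := Nat.find_spec hk
      rw [h0] at this
      simp at this
    obtain ⟨l, hl⟩ := Nat.exists_eq_succ_of_ne_zero hpos
    have h1 := Nat.find_spec hk
    rw [hl] at h1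
    have h2 := Nat.find_min hk (m := l) (by omega)
    push Not at h2
    obtain ⟨i, f, hif⟩ := exists_retract_quotient_pow P.asIdeal hx h2 h1
    exact Or.inr ⟨P, l, i, f, hif⟩

end TorsionCase

/-! ### Torsion-free pure-injectives and completions. -/

section TorsionFreeCase

variable {R : Type u} [CommRing R] [IsDedekindDomain R]

/-- An endomorphism of the `P`-adic completion of `R` that fixes `1` is the identity. -/
lemma adicCompletion_linearMap_eq_id (P : Ideal R)
    (φ : AdicCompletion P R →ₗ[R] AdicCompletion P R)
    (h : φ (AdicCompletion.of P R 1) = AdicCompletion.of P R 1) : φ = LinearMap.id := by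
  refine LinearMap.ext fun z => AdicCompletion.ext fun n => ?_
  obtain ⟨r, hr⟩ := Submodule.mkQ_surjective _ (z.val n)
  have hfg : P.FG := IsNoetherian.noetherian P
  have hof : AdicCompletion.of P R r = r • AdicCompletion.of P R 1 := by
    rw [← map_smul, smul_eq_mul, mul_one]
  -- Linear maps are P-adically continuous: as P is finitely generated, the kernel of evaluation at
  -- level n is P^n times the completion, which φ preserves.
  have h1 : z - AdicCompletion.of P R r ∈ (P ^ n • ⊤ : Submodule R (AdicCompletion P R)) := by
    rw [AdicCompletion.pow_smul_top_eq_ker_eval hfg, LinearMap.mem_ker, map_sub, sub_eq_zero]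
    exact hr.symm
  have h2 : φ (z - AdicCompletion.of P R r) ∈ (P ^ n • ⊤ : Submodule R (AdicCompletion P R)) := by
    have := Submodule.mem_map_of_mem (f := φ) h1
    rw [Submodule.map_smul''] at this
    exact Submodule.smul_mono le_rfl le_top this
  rw [AdicCompletion.pow_smul_top_eq_ker_eval hfg, LinearMap.mem_ker, map_sub, map_sub, hof,
    map_smul, h, ← hof, sub_eq_zero] at h2
  exact h2.trans hr

variable (R) (V : Type u) [AddCommGroup V] [Module R V]

/-- The diagonal map into the product of all completions. -/
noncomputable def toCompletions :
    V →ₗ[R] (∀ P : MaximalSpectrum R, AdicCompletion P.asIdeal V) :=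
  LinearMap.pi fun P => AdicCompletion.of P.asIdeal V

variable {R V}

lemma of_eq_zero_iff {I : Ideal R} {x : V} :
    AdicCompletion.of I V x = 0 ↔ ∀ k, x ∈ (I ^ k • ⊤ : Submodule R V) := by
  constructor
  · intro h k
    exact (Submodule.Quotient.mk_eq_zero _).1 (congrArg (fun z => z.val k) h)
  · intro h
    ext k
    exact (Submodule.Quotient.mk_eq_zero _).2 (h k)

/-- Divisibility by a nonzero scalar is detected by the completions. -/
lemma exists_smul_eq_of_smul_eq_toCompletions {r : R} (hr : r ≠ 0) {x : V}
    (h : ∀ (P : MaximalSpectrum R) k, r ∈ P.asIdeal ^ k → x ∈ (P.asIdeal ^ k • ⊤ : Submodule R V)) :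
    ∃ y, r • y = x := by
  have : x ∈ LinearMap.range (LinearMap.lsmul R V r) := by
    refine mem_of_forall_exists_smul_mem fun P => ?_
    have := P.isMaximal
    obtain ⟨k, hk, s, hs, hsr⟩ := exists_mul_eq_mul_of_ne_zero P.asIdeal hr
    obtain ⟨w, -, hw⟩ := exists_smul_eq_smul_of_mem_smul hsr (h P k hk)
    exact ⟨s, hs, w, hw.symm⟩
  exact this

lemma isDivisibleSubmodule_ker_toCompletions [Module.IsTorsionFree R V] :
    IsDivisibleSubmodule (LinearMap.ker (toCompletions R V)) := by
  intro r hr x hx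
  have hx' : ∀ (P : MaximalSpectrum R) k, x ∈ (P.asIdeal ^ k • ⊤ : Submodule R V) :=
    fun P => of_eq_zero_iff.1 (congrFun hx P)
  obtain ⟨y, rfl⟩ := exists_smul_eq_of_smul_eq_toCompletions hr fun P k _ => hx' P k
  refine ⟨y, ?_, rfl⟩
  ext1 P
  have := P.isMaximal
  obtain ⟨k, -, hk⟩ := exists_forall_smul_mem_pow_smul_top P.asIdeal V hr
  exact of_eq_zero_iff.2 fun m => hk m y (hx' P _)

/-- This makes the embedding of V into the product of its completions pure, so that a pure-injective
V with injective `toCompletions` splits off. -/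
instance [Module.IsTorsionFree R V] : Module.IsTorsionFree R
    ((∀ P : MaximalSpectrum R, AdicCompletion P.asIdeal V) ⧸ LinearMap.range (toCompletions R V)) := by
  rw [Module.isTorsionFree_iff_smul_eq_zero]
  intro r z hz
  by_contra! hne
  apply hne.2
  obtain ⟨z, rfl⟩ := Submodule.mkQ_surjective _ z
  rw [← map_smul] at hz
  obtain ⟨x, hx⟩ := (Submodule.Quotient.mk_eq_zero _).1 hz
  obtain ⟨y, rfl⟩ := exists_smul_eq_of_smul_eq_toCompletions hne.1 (x := x) fun P k hk => by
    have h1 : (Submodule.mkQ _ x : V ⧸ (P.asIdeal ^ k • ⊤ : Submodule R V)) = r • (z P).val k :=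
      congrArg (fun t => (t P).val k) hx
    obtain ⟨v, hv⟩ := Submodule.mkQ_surjective _ ((z P).val k)
    rw [← hv, ← map_smul] at h1
    have h2 := (Submodule.Quotient.eq _).1 h1
    have h3 : r • v ∈ (P.asIdeal ^ k • ⊤ : Submodule R V) :=
      Submodule.smul_mem_smul hk Submodule.mem_top
    simpa using add_mem h2 h3
  refine (Submodule.Quotient.mk_eq_zero _).2 ⟨y, ?_⟩
  ext1 P
  have := P.isMaximal
  have h1 : r • (toCompletions R V y P) = r • z P := by
    have h2 := congrFun hx P
    rw [map_smul] at h2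
    exact h2
  exact smul_right_injective (AdicCompletion P.asIdeal V) hne.1 h1

/-- A torsion-free quotient is the end of a pure exact sequence. -/
lemma exists_linearMap_comp_eq_id_of_isPureInjective {V W : Type u} [AddCommGroup V] [Module R V]
    [AddCommGroup W] [Module R W] (hV : IsPureInjective (ModuleCat.of R V)) (i : V →ₗ[R] W)
    (hi : Function.Injective i) [Module.IsTorsionFree R (W ⧸ LinearMap.range i)] :
    ∃ ρ : W →ₗ[R] V, ρ ∘ₗ i = LinearMap.id := by
  let S : ShortComplex (ModuleCat.{u} R) :=
    { X₁ := ModuleCat.of R V, X₂ := ModuleCat.of R W,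
      X₃ := ModuleCat.of R (W ⧸ LinearMap.range i), f := ModuleCat.ofHom i,
      g := ModuleCat.ofHom (LinearMap.range i).mkQ
      zero := by
        ext x
        exact (Submodule.Quotient.mk_eq_zero _).2 (LinearMap.mem_range_self _ _) }
  have hS : S.ShortExact := ModuleCat.shortComplex_shortExact S
    (fun x => Submodule.Quotient.mk_eq_zero _) hi (Submodule.mkQ_surjective _)
  have hpure : IsPureExact S := by
    refine ⟨hS, fun F hF f => ?_⟩
    have : Module.Finite R (LinearMap.range f.hom) := inferInstance
    -- The image of F is finitely generated and torsion-free, hence projective, and lifts to W; this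
    -- is purity.
    have : Module.Projective R (LinearMap.range f.hom) :=
      have : Module.IsTorsionFree R (W ⧸ LinearMap.range i) := inferInstance
      inferInstanceAs (Module.Projective R
        (LinearMap.range (f.hom : F →ₗ[R] W ⧸ LinearMap.range i)))
    obtain ⟨h, hh⟩ := Module.projective_lifting_property (LinearMap.range i).mkQ
      (LinearMap.range f.hom).subtype (Submodule.mkQ_surjective _)
    refine ⟨ModuleCat.ofHom (h ∘ₗ f.hom.rangeRestrict), ?_⟩
    ext x
    exact LinearMap.congr_fun hh (f.hom.rangeRestrict x)
  obtain ⟨g, hg⟩ := hV S hpure (𝟙 _)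
  exact ⟨g.hom, congrArg ModuleCat.Hom.hom hg⟩

/-- Elements of the product of the completions with trivial `P`-component are divisible by all
powers of `P`. -/
lemma mem_pow_smul_top_of_apply_eq_zero (P : MaximalSpectrum R)
    (w : ∀ P : MaximalSpectrum R, AdicCompletion P.asIdeal V) (hw : w P = 0) (m : ℕ) :
    w ∈ (P.asIdeal ^ m • ⊤ :
      Submodule R (∀ P : MaximalSpectrum R, AdicCompletion P.asIdeal V)) := by
  classical
  obtain ⟨k, a, ha⟩ := Submodule.fg_iff_exists_fin_generating_family.1
    (IsNoetherian.noetherian (P.asIdeal ^ m))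
  have hmem : ∀ i, a i ∈ P.asIdeal ^ m := fun i => ha ▸ Submodule.subset_span (Set.mem_range_self i)
  have key : ∀ Q : MaximalSpectrum R, ∃ v : Fin k → AdicCompletion Q.asIdeal V,
      w Q = ∑ i, a i • v i := by
    intro Q
    by_cases hQ : Q = P
    · subst hQ
      exact ⟨0, by simp [hw]⟩
    -- Some generator of P^m acts invertibly on the Q-adic component. One finite generating set
    -- serves all Q, so the infinite product needs only a finite sum.
    · have hex : ∃ i, a i ∉ Q.asIdeal := by
        by_contra! hall
        have hle : P.asIdeal ^ m ≤ Q.asIdeal := by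
          rw [← ha]
          exact Submodule.span_le.2 (by rintro _ ⟨i, rfl⟩; exact hall i)
        exact hQ (MaximalSpectrum.ext (P.isMaximal.eq_of_le Q.isMaximal.ne_top
          (Q.isMaximal.isPrime.le_of_pow_le hle))).symm
      obtain ⟨i, hi⟩ := hex
      have := Q.isMaximal
      obtain ⟨z, hz⟩ := adicCompletion_smul_surjective Q.asIdeal hi (w Q)
      refine ⟨Pi.single i z, ?_⟩
      rw [Finset.sum_eq_single i (fun j _ hj => by rw [Pi.single_eq_of_ne hj, smul_zero])
        (fun h => absurd (Finset.mem_univ i) h), Pi.single_eq_same, hz]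
  choose v hv using key
  have : w = ∑ i, a i • (fun Q => v Q i) := by
    ext1 Q
    rw [hv Q, Finset.sum_apply]
    rfl
  rw [this]
  exact Submodule.sum_mem _ fun i _ => Submodule.smul_mem_smul (hmem i) Submodule.mem_top

/-- A torsion-free module with `P V ≠ V` has an element that some map to the `P`-adic completion
sends to `1`. -/
lemma exists_adicCompletion_functional [Module.IsTorsionFree R V] (P : Ideal R) [P.IsMaximal]
    (hP : P ≠ ⊥) (hV : (P • ⊤ : Submodule R V) ≠ ⊤) :
    ∃ (x : V) (β : AdicCompletion P V →ₗ[R] AdicCompletion P R),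
      β (AdicCompletion.of P V x) = AdicCompletion.of P R 1 := by
  let _ : Field (R ⧸ P) := Ideal.Quotient.field P
  let π := (P • ⊤ : Submodule R V).mkQ
  have : Nontrivial (V ⧸ (P • ⊤ : Submodule R V)) := Submodule.Quotient.nontrivial_iff.2 hV
  let b := Module.Free.chooseBasis (R ⧸ P) (V ⧸ (P • ⊤ : Submodule R V))
  let ι := Module.Free.ChooseBasisIndex (R ⧸ P) (V ⧸ (P • ⊤ : Submodule R V))
  have hι : Nonempty ι := b.index_nonempty
  obtain ⟨i₀⟩ := hι
  choose x hx using fun i : ι => Submodule.mkQ_surjective _ (b i)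
  -- Lifting a basis of V/PV gives a map from a free module that becomes an isomorphism on P-adic
  -- completions. A coordinate functional of the free module then provides β.
  let Φ : (ι →₀ R) →ₗ[R] V := Finsupp.linearCombination R x
  have hπΦ : ∀ f : ι →₀ R, π (Φ f) = f.sum fun i c => Ideal.Quotient.mk P c • b i := by
    intro f
    rw [Finsupp.linearCombination_apply, map_finsuppSum]
    refine Finsupp.sum_congr fun i _ => ?_
    rw [map_smul, hx]
    rfl
  have hcoef : ∀ f : ι →₀ R, Φ f ∈ (P • ⊤ : Submodule R V) → ∀ i, f i ∈ P := by
    intro f hf i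
    have h0 : π (Φ f) = 0 := (Submodule.Quotient.mk_eq_zero _).2 hf
    rw [hπΦ] at h0
    have h1 := congrArg (fun t => b.repr t i) h0
    simp only [map_finsuppSum, map_smul, Module.Basis.repr_self, map_zero, Finsupp.zero_apply,
      Finsupp.sum_apply, Finsupp.smul_single, smul_eq_mul, mul_one] at h1
    rw [Finsupp.sum, Finset.sum_eq_single i (fun j _ hj => Finsupp.single_eq_of_ne hj.symm)
      (fun h => by simp [Finsupp.notMem_support_iff.1 h]), Finsupp.single_eq_same] at h1
    exact Ideal.Quotient.eq_zero_iff_mem.1 h1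
  have hmem : ∀ f : ι →₀ R, (∀ i, f i ∈ P) → f ∈ (P • ⊤ : Submodule R (ι →₀ R)) := by
    intro f hf
    rw [← Finsupp.sum_single f]
    refine Submodule.sum_mem _ fun i _ => ?_
    rw [← mul_one (f i), ← smul_eq_mul, ← Finsupp.smul_single]
    exact Submodule.smul_mem_smul (hf i) Submodule.mem_top
  obtain ⟨a, ha, ha'⟩ := SetLike.exists_of_lt (Ideal.pow_succ_lt_pow hP 1)
  have ha0 : a ≠ 0 := fun h => ha' (h ▸ zero_mem _)
  obtain ⟨s, hs, hsa⟩ := exists_mul_eq_mul_of_mem_pow P ha'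
  rw [pow_one] at hsa ha
  -- Injectivity modulo P climbs to P^n: up to s, divide f by a ∈ P outside P² and cancel a in the
  -- torsion-free V.
  have hinj : ∀ (n : ℕ) (f : ι →₀ R), Φ f ∈ (P ^ n • ⊤ : Submodule R V) →
      f ∈ (P ^ n • ⊤ : Submodule R (ι →₀ R)) := by
    intro n
    induction n with
    | zero => intro f _; simp
    | succ n ih =>
      intro f hf
      have hf1 := hmem f (hcoef f (Submodule.smul_mono_left (Ideal.pow_le_self (by omega)) hf))
      obtain ⟨f', -, hf'⟩ := exists_smul_eq_smul_of_mem_smul hsa hf1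
      have hsf : s • Φ f ∈ (P ^ (n + 1) • ⊤ : Submodule R V) := Submodule.smul_mem _ _ hf
      rw [← map_smul, hf', map_smul, pow_succ', mul_smul] at hsf
      obtain ⟨w, hw, h3⟩ := exists_smul_eq_smul_of_mem_smul hsa hsf
      rw [smul_comm] at h3
      have h4 : Φ (s • f') = w := by
        rw [map_smul]
        exact smul_right_injective V ha0 h3
      have h5 := ih (s • f') (h4 ▸ hw)
      have h6 : s • s • f ∈ (P ^ (n + 1) • ⊤ : Submodule R (ι →₀ R)) := by
        rw [hf', smul_comm, pow_succ', mul_smul]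
        exact Submodule.smul_mem_smul ha h5
      refine mem_of_smul_mem_of_notMem (n := n + 1) hs
        (mem_of_smul_mem_of_notMem (n := n + 1) hs h6 ?_) ?_
      all_goals exact fun p hp => Submodule.smul_mem_smul hp Submodule.mem_top
  have hsurj : Function.Surjective (π ∘ₗ Φ) := by
    intro v
    have hv : v ∈ Submodule.span (R ⧸ P) (Set.range b) := b.mem_span v
    change v ∈ LinearMap.range (π ∘ₗ Φ)
    refine Submodule.span_induction ?_ (zero_mem _) (fun _ _ _ _ => add_mem) ?_ hv
    · rintro _ ⟨i, rfl⟩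
      exact ⟨Finsupp.single i 1, by simp [Φ, π, hx i]⟩
    · intro c y _ hy
      obtain ⟨c, rfl⟩ := Ideal.Quotient.mk_surjective c
      exact Submodule.smul_mem _ c hy
  let Ψ : AdicCompletion P (ι →₀ R) →ₗ[R] AdicCompletion P V :=
    (AdicCompletion.map P Φ).restrictScalars R
  have hΨ : Function.Bijective Ψ := by
    refine ⟨(injective_iff_map_eq_zero _).2 fun z hz => AdicCompletion.ext fun n => ?_,
      AdicCompletion.map_surjective_of_mkQ_comp_surjective hsurj⟩
    obtain ⟨f, hf⟩ := Submodule.mkQ_surjective _ (z.val n)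
    have h1 : (Submodule.mkQ _ (Φ f) : V ⧸ (P ^ n • ⊤ : Submodule R V)) = 0 := by
      have h2 : (Ψ z).val n = 0 := congrArg (fun t => t.val n) hz
      rw [← h2]
      change _ = Φ.reduceModIdeal (P ^ n) (z.val n)
      rw [← hf]
      rfl
    rw [← hf]
    exact (Submodule.Quotient.mk_eq_zero _).2 (hinj n f ((Submodule.Quotient.mk_eq_zero _).1 h1))
  let e := LinearEquiv.ofBijective Ψ hΨ
  refine ⟨x i₀, (AdicCompletion.map P (Finsupp.lapply i₀ : (ι →₀ R) →ₗ[R] R)).restrictScalars R ∘ₗ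
    e.symm.toLinearMap, ?_⟩
  have h1 : e (AdicCompletion.of P _ (Finsupp.single i₀ 1)) = AdicCompletion.of P V (x i₀) := by
    change AdicCompletion.map P Φ _ = _
    rw [AdicCompletion.map_of]
    simp [Φ]
  change AdicCompletion.map P _ (e.symm (AdicCompletion.of P V (x i₀))) = _
  rw [← h1, e.symm_apply_apply, AdicCompletion.map_of]
  simp

/-- A torsion-free pure-injective module without nonzero divisible submodules has the `P`-adic
completion of `R` as a direct summand whenever `P V ≠ V`. -/
lemma exists_retract_adicCompletion [Module.IsTorsionFree R V]
    (hV : IsPureInjective (ModuleCat.of R V))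
    (hred : ∀ D : Submodule R V, IsDivisibleSubmodule D → D = ⊥) (P : MaximalSpectrum R)
    (hP : P.asIdeal ≠ ⊥) (hPV : (P.asIdeal • ⊤ : Submodule R V) ≠ ⊤) :
    ∃ (i : AdicCompletion P.asIdeal R →ₗ[R] V) (f : V →ₗ[R] AdicCompletion P.asIdeal R),
      f ∘ₗ i = LinearMap.id := by
  classical
  have := P.isMaximal
  have hinj : Function.Injective (toCompletions R V) :=
    LinearMap.ker_eq_bot.1 (hred _ isDivisibleSubmodule_ker_toCompletions)
  obtain ⟨ρ, hρ⟩ := exists_linearMap_comp_eq_id_of_isPureInjective hV _ hinj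
  obtain ⟨x, β, hβ⟩ := exists_adicCompletion_functional P.asIdeal hP hPV
  let j : AdicCompletion P.asIdeal V →ₗ[R]
      (∀ P : MaximalSpectrum R, AdicCompletion P.asIdeal V) :=
    LinearMap.single R (fun P : MaximalSpectrum R => AdicCompletion P.asIdeal V) P
  let α : AdicCompletion P.asIdeal R →ₗ[R] V :=
    ρ ∘ₗ j ∘ₗ (AdicCompletion.map P.asIdeal (LinearMap.toSpanSingleton R V x)).restrictScalars R
  refine ⟨α, β ∘ₗ AdicCompletion.of P.asIdeal V, adicCompletion_linearMap_eq_id P.asIdeal _ ?_⟩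
  have hα : α (AdicCompletion.of P.asIdeal R 1) = ρ (j (AdicCompletion.of P.asIdeal V x)) := by
    change ρ (j (AdicCompletion.map P.asIdeal _ _)) = _
    rw [AdicCompletion.map_of]
    simp
  -- Replacing x by its P-component changes ρ only by ρ w, of infinite P-height, which the
  -- completion at P ignores. So the composite fixes 1 and is the identity.
  let w := toCompletions R V x - j (AdicCompletion.of P.asIdeal V x)
  have hw : w P = 0 := by
    change AdicCompletion.of P.asIdeal V x - j (AdicCompletion.of P.asIdeal V x) P = 0
    rw [sub_eq_zero]
    exact (Pi.single_eq_same (M := fun P : MaximalSpectrum R => AdicCompletion P.asIdeal V) P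
      (AdicCompletion.of P.asIdeal V x)).symm
  have hρw : AdicCompletion.of P.asIdeal V (ρ w) = 0 := by
    refine of_eq_zero_iff.2 fun k => ?_
    have := Submodule.mem_map_of_mem (f := ρ) (mem_pow_smul_top_of_apply_eq_zero P w hw k)
    rw [Submodule.map_smul''] at this
    exact Submodule.smul_mono le_rfl le_top this
  have hsub : ρ w = x - ρ (j (AdicCompletion.of P.asIdeal V x)) := by
    rw [map_sub]
    congr 1
    exact LinearMap.congr_fun hρ x
  rw [hsub, map_sub, sub_eq_zero] at hρw
  change β (AdicCompletion.of P.asIdeal V (α _)) = _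
  rw [hα, ← hρw, hβ]

end TorsionFreeCase

/-! ### Classification of the Ziegler points. -/

section Classification

variable {R : Type u} [CommRing R] [IsDedekindDomain R]

lemma isDivisibleSubmodule_top_of_smul_eq_top {V : Type u} [AddCommGroup V] [Module R V]
    (h : ∀ P : MaximalSpectrum R, (P.asIdeal • ⊤ : Submodule R V) = ⊤) :
    IsDivisibleSubmodule (⊤ : Submodule R V) := by
  intro r hr x _
  have hpow : ∀ (P : MaximalSpectrum R) k, (P.asIdeal ^ k • ⊤ : Submodule R V) = ⊤ := by
    intro P k
    induction k with
    | zero => simp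
    | succ k ih => rw [pow_succ, mul_smul, h, ih]
  obtain ⟨y, hy⟩ := exists_smul_eq_of_smul_eq_toCompletions hr (x := x)
    fun P k _ => by rw [hpow]; exact Submodule.mem_top
  exact ⟨y, Submodule.mem_top, hy⟩

/-- The points of the Ziegler spectrum of a Dedekind domain. -/
theorem IsZieglerPoint.injective_or_nonempty_iso {N : ModuleCat.{u} R} (hN : IsZieglerPoint N) :
    Injective N ∨ (∃ (P : MaximalSpectrum R) (l : ℕ),
      Nonempty (N ≅ ModuleCat.of R (R ⧸ P.asIdeal ^ (l + 1)))) ∨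
    ∃ P : MaximalSpectrum R, Nonempty (N ≅ adic P) := by
  by_cases hinj : Injective N
  · exact Or.inl hinj
  right
  have hred : ∀ D : Submodule R N, IsDivisibleSubmodule D → D = ⊥ := fun D hD => by
    by_contra h
    exact hinj (injective_of_isDivisibleSubmodule hN.1 hD h)
  have htop : ¬ IsDivisibleSubmodule (⊤ : Submodule R N) := fun h => by
    have h0 := hred _ h
    exact hN.1.1 (by
      have : Subsingleton N := (Submodule.subsingleton_iff R).1 (subsingleton_of_bot_eq_top h0.symm)
      exact ModuleCat.isZero_of_subsingleton N)
  -- Over a field every module is divisible, which is already excluded.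
  have hR : ∀ P : MaximalSpectrum R, P.asIdeal ≠ ⊥ := by
    intro P hP
    refine htop fun r hr x _ => ?_
    obtain ⟨y, p, hp, h⟩ := P.isMaximal.exists_inv (x := r) (by rwa [hP, Submodule.mem_bot])
    rw [hP, Submodule.mem_bot] at hp
    exact ⟨y • x, Submodule.mem_top, by
      rw [← mul_smul, mul_comm, ← add_zero (y * r), ← hp, h, one_smul]⟩
  by_cases htf : Module.IsTorsionFree R N
  · right
    obtain ⟨P, hP⟩ : ∃ P : MaximalSpectrum R, (P.asIdeal • ⊤ : Submodule R N) ≠ ⊤ := by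
      by_contra! h
      exact htop (isDivisibleSubmodule_top_of_smul_eq_top h)
    have := P.isMaximal
    obtain ⟨i, f, hif⟩ := exists_retract_adicCompletion hN.2 hred P (hR P) hP
    refine ⟨P, nonempty_iso_of_indecomposable hN.1 (A := adic P) (ModuleCat.ofHom i)
      (ModuleCat.ofHom f) (ModuleCat.hom_ext hif) fun h0 => ?_⟩
    have := ModuleCat.subsingleton_of_isZero h0
    have h1 := of_eq_zero_iff.1 (Subsingleton.elim (α := adic P)
      (AdicCompletion.of P.asIdeal R 1) 0) 1
    rw [pow_one, smul_eq_mul, Ideal.mul_top] at h1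
    exact (Ideal.ne_top_iff_one _).1 P.isMaximal.ne_top h1
  · left
    obtain ⟨D, hD, hD0⟩ | ⟨P, l, i, f, hif⟩ := exists_divisible_or_exists_retract hR htf
    · exact absurd (hred D hD) hD0
    refine ⟨P, l, nonempty_iso_of_indecomposable hN.1
      (A := ModuleCat.of R (R ⧸ P.asIdeal ^ (l + 1))) (ModuleCat.ofHom i)
      (ModuleCat.ofHom f) (ModuleCat.hom_ext hif) fun h0 => ?_⟩
    have h1 : Subsingleton (R ⧸ P.asIdeal ^ (l + 1)) := ModuleCat.subsingleton_of_isZero h0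
    rw [Ideal.Quotient.subsingleton_iff] at h1
    exact P.isMaximal.ne_top (top_le_iff.1 (h1 ▸ Ideal.pow_le_self (Nat.succ_ne_zero l)))

/-- The quotients `R ⧸ P ^ (l + 1)` have finite length. -/
lemma isFiniteLength_quotient_pow (P : MaximalSpectrum R) (l : ℕ) :
    IsFiniteLength R (R ⧸ P.asIdeal ^ l) := by
  have hprime : ∀ J : Ideal (R ⧸ P.asIdeal ^ l), J.IsPrime → J.IsMaximal := by
    intro J hJ
    have hle : P.asIdeal ≤ J.comap (Ideal.Quotient.mk (P.asIdeal ^ l)) := by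
      refine Ideal.IsPrime.le_of_pow_le (n := l) fun x hx => ?_
      have h0 : Ideal.Quotient.mk (P.asIdeal ^ l) x = 0 := Ideal.Quotient.eq_zero_iff_mem.2 hx
      rw [Ideal.mem_comap, h0]
      exact zero_mem _
    have heq := P.isMaximal.eq_of_le (Ideal.IsPrime.ne_top inferInstance) hle
    have : (J.comap (Ideal.Quotient.mk (P.asIdeal ^ l))).IsMaximal := heq ▸ P.isMaximal
    rw [← Ideal.map_comap_of_surjective _ Ideal.Quotient.mk_surjective J]
    refine (Ideal.map_eq_top_or_isMaximal_of_surjective _ Ideal.Quotient.mk_surjective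
      this).resolve_left fun h => hJ.ne_top ?_
    rwa [Ideal.map_comap_of_surjective _ Ideal.Quotient.mk_surjective] at h
  have : IsArtinianRing (R ⧸ P.asIdeal ^ l) :=
    isArtinianRing_iff_isNoetherianRing_krullDimLE_zero.2
      ⟨inferInstance, Ring.krullDimLE_zero_iff.2 fun J hJ => hprime J hJ⟩
  exact isFiniteLength_iff_isNoetherian_isArtinian.2 ⟨inferInstance,
    isArtinian_of_surjective_algebraMap (Ideal.Quotient.mk_surjective (I := P.asIdeal ^ l))⟩

end Classification

/-! ### Reduction of a Ziegler-closed set to its standard points. -/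

section ZieglerClosed

variable {R : Type u} [CommRing R]

lemma indecomposable_of_iso {N N' : ModuleCat.{u} R} (e : N ≅ N') (h : Indecomposable N) :
    Indecomposable N' :=
  ⟨fun h0 => h.1 (h0.of_iso e), fun A B i => h.2 A B (e ≪≫ i)⟩

lemma IsPureInjective.of_iso {N N' : ModuleCat.{u} R} (e : N ≅ N') (h : IsPureInjective N) :
    IsPureInjective N' := fun S hS f => by
  obtain ⟨g, hg⟩ := h S hS (f ≫ e.inv)
  exact ⟨g ≫ e.hom, by rw [← Category.assoc, hg, Category.assoc, e.inv_hom_id, Category.comp_id]⟩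

lemma IsZieglerClosed.of_iso {U : ObjectProperty (ModuleCat.{u} R)} (hU : IsZieglerClosed U)
    {N N' : ModuleCat.{u} R} (e : N ≅ N') (h : U N) : U N' := by
  obtain ⟨T, hT⟩ := hU
  obtain ⟨⟨h1, h2⟩, h3⟩ := (hT N).1 h
  refine (hT N').2 ⟨⟨indecomposable_of_iso e h1, h2.of_iso e⟩, fun A B s hs f => ?_⟩
  obtain ⟨g, hg⟩ := h3 s hs (f ≫ e.inv)
  exact ⟨g ≫ e.hom, by rw [← Category.assoc, hg, Category.assoc, e.inv_hom_id, Category.comp_id]⟩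

/-- Injective modules impose no condition on the sequences in an exact structure. -/
lemma exactStructure_le_of_forall_injective_or [IsNoetherianRing R]
    {U V : ObjectProperty (ModuleCat.{u} R)} (h : ∀ N, V N → Injective N ∨ U N) :
    exactStructure U ≤ exactStructure V := by
  refine fun S hS => ⟨hS.1, fun N hN f => ?_⟩
  obtain hinj | hUN := h N hN
  · have : Mono S.f := hS.1.mono_f
    have : Mono S.f.hom :=
      inferInstanceAs (Mono ((forget₂ (FGModuleCat.{u} R) (ModuleCat.{u} R)).map S.f))
    exact ⟨Injective.factorThru f S.f.hom, Injective.comp_factorThru f S.f.hom⟩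
  · exact hS.2 N hUN f

variable [IsDedekindDomain R] (M : Set (MaximalSpectrum R)) (n : MaximalSpectrum R → ℕ)

/-- A Ziegler-closed set defines the same exact structure as its points of finite length together
with the completions in it. -/
theorem IsZieglerClosed.exactStructure_eq {U : ObjectProperty (ModuleCat.{u} R)}
    (hU : IsZieglerClosed U)
    (hfl : ∀ N : ModuleCat.{u} R, (U N ∧ IsFiniteLength R N) ↔
      finiteLengthPoints (initialSegments M n) N) :
    exactStructure U = exactStructure (standardPoints M n {P | U (adic P)}) := by
  refine le_antisymm (exactStructure_le_of_forall_injective_or ?_)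
    (exactStructure_le_of_forall_injective_or ?_)
  · rintro N (hN | hN | ⟨P, hP, ⟨e⟩⟩)
    · exact Or.inr ((hfl N).2 hN).1
    · exact Or.inl hN.2
    · exact Or.inr (hU.of_iso e.symm hP)
  · intro N hN
    have hZ : IsZieglerPoint N := by
      obtain ⟨T, hT⟩ := hU
      exact ((hT N).1 hN).1
    obtain h | ⟨P, l, ⟨e⟩⟩ | ⟨P, ⟨e⟩⟩ := hZ.injective_or_nonempty_iso
    · exact Or.inl h
    · exact Or.inr (Or.inl ((hfl N).1 ⟨hN,
        e.toLinearEquiv.symm.isFiniteLength (isFiniteLength_quotient_pow P (l + 1))⟩))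
    · exact Or.inr (Or.inr (Or.inr ⟨P, hU.of_iso e hN, ⟨e⟩⟩))

lemma exactStructure_sup_maxPoints :
    exactStructure (finiteLengthPoints (initialSegments M n) ⊔ maxPoints R) =
      exactStructure (standardPoints M n ∅) := by
  congr 2
  ext N
  simp [adicPoints]

lemma relExt_adicPoints_empty (X Y : ModuleCat.{u} R) :
    relExt (adicPoints (∅ : Set (MaximalSpectrum R))) X Y = ⊤ :=
  eq_top_iff.2 fun _ _ => mem_relExt_adicPoints.2 fun _ hP => hP.elim

end ZieglerClosed

end DedekindExact

theorem mainTheorem10 (R : Type u) [CommRing R] [IsDedekindDomain R]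
    (M : Set (MaximalSpectrum R)) (n : MaximalSpectrum R → ℕ) :
    -- every exact structure `ℰ^𝒰` such that the points of finite length of `𝒰` are `ℱ_L`
    (∀ U : ObjectProperty (ModuleCat.{u} R), DedekindExact.IsZieglerClosed U →
      (∀ N : ModuleCat.{u} R, (U N ∧ IsFiniteLength R N) ↔
        DedekindExact.finiteLengthPoints (DedekindExact.initialSegments M n) N) →
      DedekindExact.IsHereditaryExact (DedekindExact.exactStructure U) ∧
      ∀ X Y : FGModuleCat.{u} R, ∃ N : Submodule R (DedekindExact.ExtR X Y),
        (N : Set (DedekindExact.ExtR X Y)) =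
          DedekindExact.extOne (DedekindExact.exactStructure
            (DedekindExact.adicPoints {P | U (DedekindExact.adic P)})) X Y ∧
        DedekindExact.IsDirectSum
          (DedekindExact.extOne (DedekindExact.exactStructure U) X Y)
          (DedekindExact.radSummand M n N)) ∧
    -- the exact structure `ℰ_L`, that is, `ℰ^𝒰` for `𝒰 = ℱ_L ∪ 𝒰_max`
    (DedekindExact.IsHereditaryExact (DedekindExact.exactStructure
        (DedekindExact.finiteLengthPoints (DedekindExact.initialSegments M n) ⊔
          DedekindExact.maxPoints R)) ∧
      ∀ X Y : FGModuleCat.{u} R,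
        DedekindExact.IsDirectSum
          (DedekindExact.extOne (DedekindExact.exactStructure
            (DedekindExact.finiteLengthPoints (DedekindExact.initialSegments M n) ⊔
              DedekindExact.maxPoints R)) X Y)
          (DedekindExact.radSummand M n (⊤ : Submodule R (DedekindExact.ExtR X Y)))) := by
  refine ⟨fun U hU hfl => ?_, ?_⟩
  · rw [hU.exactStructure_eq M n hfl]
    exact ⟨DedekindExact.isHereditaryExact_standardPoints M n _, fun X Y =>
      ⟨_, (DedekindExact.extOne_eq_relExt _ X Y).symm,
        DedekindExact.isDirectSum_standardPoints M n _ X Y⟩⟩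
  · rw [DedekindExact.exactStructure_sup_maxPoints]
    refine ⟨DedekindExact.isHereditaryExact_standardPoints M n _, fun X Y => ?_⟩
    rw [← DedekindExact.relExt_adicPoints_empty]
    exact DedekindExact.isDirectSum_standardPoints M n _ X Y
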